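/- Let $k$ be a field of characteristic zero, $R=k[x_1,x_2,x_3,x_4]$ with the standard grading, and let $\mathcal Q\subset\mathbb P^3_k$ be a smooth quadric surface defined by a quadratic form $Q$. Let $b\ge a\ge 2$ and let $X$ be an $a\times b$ grid on $\mathcal Q$, that is, the set of the $ab$ points in which $a$ distinct lines of one ruling of $\mathcal Q$ meet $b$ distinct lines of the other ruling (all lines being defined over $k$). Let $I_X\subset R$ be the homogeneous ideal of $X$. For $d\ge 1$ let $X^{(d)}\subset\mathbb P^3$ be the scheme of fat points with saturated ideal $I_X^{(d)}=(I_X^d)^{\mathrm{sat}}$, and let $Y_d\subset\mathbb P^3$ be the scheme with saturated ideal $I_{Y_d}=(I_X^{(d)}+(Q))^{\mathrm{sat}}$. For a zero-dimensional scheme $Z\subset\mathbb P^3$ with saturated ideal $I_Z$ write $h_Z(t)=\dim_k[R/I_Z]_t$; the multiplicity of $Z$ is the constant value of $h_Z(t)$ for $t\gg 0$, and $Z$ imposes independent conditions on forms of degree $t$ if $h_Z(t)$ equals the multiplicity of $Z$. Then, for every $d\ge 1$: (a) $h_{Y_d}(bd-1)$ is equal to the multiplicity of $Y_d$, and $$h_{Y_d}(bd-1)=ab\binom{d+1}{2};$$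 that is, $Y_d$ imposes independent conditions on forms of degree $bd-1$. (b) $h_{X^{(d)}}(bd-1)$ is equal to the multiplicity of $X^{(d)}$, and $$h_{X^{(d)}}(bd-1)=ab\binom{d+2}{3};$$ that is, $X^{(d)}$ imposes independent conditions on forms of degree $bd-1$. -/

import Mathlib

open MvPolynomial

/-- The `k`-points of projective 3-space. -/
abbrev P3 (k : Type*) [Field k] : Type _ := Projectivization k (Fin 4 → k)

/-- The form `Q` defines a smooth quadric surface: it is a quadratic form whose partial derivatives
have no common zero at a point of the surface. (The partial derivatives are linear forms, so in
characteristic zero a common zero over an extension field of `k` exists iff one exists over `k`.) -/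
def IsSmoothQuadric {k : Type*} [Field k] (Q : MvPolynomial (Fin 4) k) : Prop :=
  Q.IsHomogeneous 2 ∧
    ∀ v : Fin 4 → k, v ≠ 0 → eval v Q = 0 → ∃ i : Fin 4, eval v (pderiv i Q) ≠ 0

/-- `L`, a two-dimensional subspace of `k⁴`, is a line of projective 3-space that lies on `Q = 0`. -/
def IsLineOn {k : Type*} [Field k] (Q : MvPolynomial (Fin 4) k)
    (L : Submodule k (Fin 4 → k)) : Prop :=
  Module.finrank k L = 2 ∧ ∀ v ∈ L, eval v Q = 0

/-- A ruling of the smooth quadric `Q = 0`: a class of lines on the quadric for the equivalence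
relation "equal or disjoint". -/
def IsRuling {k : Type*} [Field k] (Q : MvPolynomial (Fin 4) k)
    (𝓡 : Set (Submodule k (Fin 4 → k))) : Prop :=
  𝓡.Nonempty ∧ (∀ L ∈ 𝓡, IsLineOn Q L) ∧
    ∀ L ∈ 𝓡, ∀ M, IsLineOn Q M → (M ∈ 𝓡 ↔ M = L ∨ M ⊓ L = ⊥)

/-- `X` is an `a × b` grid on the quadric `Q = 0`: the set of intersection points of `a` distinct
lines in one ruling with `b` distinct lines in the other ruling. -/
def IsGrid {k : Type*} [Field k] (Q : MvPolynomial (Fin 4) k) (a b : ℕ)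
    (X : Set (P3 k)) : Prop :=
  ∃ 𝓡₁ 𝓡₂ : Set (Submodule k (Fin 4 → k)), IsRuling Q 𝓡₁ ∧ IsRuling Q 𝓡₂ ∧ 𝓡₁ ≠ 𝓡₂ ∧
    ∃ (l : Fin a → Submodule k (Fin 4 → k)) (m : Fin b → Submodule k (Fin 4 → k)),
      Function.Injective l ∧ Function.Injective m ∧ (∀ i, l i ∈ 𝓡₁) ∧ (∀ j, m j ∈ 𝓡₂) ∧
        X = {P | ∃ i j, P.submodule ≤ l i ⊓ m j}

/-- The homogeneous ideal `I_X` of a set of points, generated by the forms that vanish on it. -/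
noncomputable def pointsIdeal {k : Type*} [Field k] (X : Set (P3 k)) : Ideal (MvPolynomial (Fin 4) k) :=
  Ideal.span {f | (∃ t, f.IsHomogeneous t) ∧ ∀ P ∈ X, ∀ v ∈ P.submodule, eval v f = 0}

/-- The saturation of an ideal with respect to the irrelevant ideal `(x₀, x₁, x₂, x₃)`. -/
noncomputable def satIdeal {k : Type*} [Field k] (I : Ideal (MvPolynomial (Fin 4) k)) :
    Ideal (MvPolynomial (Fin 4) k) where
  carrier := {f | ∃ N : ℕ, ∀ g ∈ idealOfVars (Fin 4) k ^ N, g * f ∈ I}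
  zero_mem' := ⟨0, fun g _ => by simp⟩
  add_mem' := by
    rintro f₁ f₂ ⟨N₁, h₁⟩ ⟨N₂, h₂⟩
    refine ⟨max N₁ N₂, fun g hg => ?_⟩
    rw [mul_add]
    exact I.add_mem (h₁ g (Ideal.pow_le_pow_right (le_max_left _ _) hg))
      (h₂ g (Ideal.pow_le_pow_right (le_max_right _ _) hg))
  smul_mem' := by
    rintro c f ⟨N, h⟩
    refine ⟨N, fun g hg => ?_⟩
    rw [smul_eq_mul, mul_left_comm]
    exact I.mul_mem_left c (h g hg)

/-- The symbolic power `I_X^{(d)} = (I_X ^ d)^sat`, which is the ideal of the fat point scheme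
`X^{(d)}`. -/
noncomputable def fatIdeal {k : Type*} [Field k] (X : Set (P3 k)) (d : ℕ) : Ideal (MvPolynomial (Fin 4) k) :=
  satIdeal (pointsIdeal X ^ d)

/-- The ideal `(I_X^{(d)} + (Q))^sat` of the scheme `Y_d` cut out by `X^{(d)}` on `Q = 0`, as a
subscheme of projective 3-space. -/
noncomputable def sliceIdeal {k : Type*} [Field k] (Q : MvPolynomial (Fin 4) k) (X : Set (P3 k)) (d : ℕ) :
    Ideal (MvPolynomial (Fin 4) k) :=
  satIdeal (fatIdeal X d ⊔ Ideal.span {Q})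

/-- The Hilbert function `t ↦ dim_k [R/I]_t`, where `[R/I]_t` is the image of the space of forms of
degree `t`. -/
noncomputable def hilbertFn {k : Type*} [Field k] (I : Ideal (MvPolynomial (Fin 4) k))
    (t : ℕ) : ℕ :=
  Module.finrank k ((homogeneousSubmodule (Fin 4) k t).map (Ideal.Quotient.mkₐ k I).toLinearMap)

/-- The zero-dimensional scheme with saturated ideal `I` has multiplicity (degree) `m`: its Hilbert
polynomial is the constant `m`, i.e. its Hilbert function is eventually equal to `m`. -/
def HasMultiplicity {k : Type*} [Field k] (I : Ideal (MvPolynomial (Fin 4) k)) (m : ℕ) : Prop :=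
  ∀ᶠ t in Filter.atTop, hilbertFn I t = m

/-- The zero-dimensional scheme with saturated ideal `I` imposes independent conditions on forms of
degree `t`: the value of its Hilbert function in degree `t` is its multiplicity. -/
def ImposesIndependentConditions {k : Type*} [Field k] (I : Ideal (MvPolynomial (Fin 4) k))
    (t : ℕ) : Prop :=
  HasMultiplicity I (hilbertFn I t)

/-! Both claims come from one squeeze. Let h_d and g_d be the Hilbert functions of X^(d) and Y_d.

(1) h_d(t) ≤ ab·C(d+2,3) for every t. The intersection of the d-th powers of the ideals of the
points lies in I_X^(d), and each of these powers has Hilbert function at most C(d+2,3)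
(`iInf_frameIdeal_pow_le_fatIdeal`, `hilbertFn_fatIdeal_le`).

(2) g_d(t) ≥ ab·C(d+1,2) once bd ≤ t+1. On the parametrized quadric, forms of degree t restrict to
polynomials of degree at most t in each of x and y. Products G(x)H(y) of Hermite interpolants, of
degrees below ad and bd, realize any Taylor coefficients of order below d at all grid points
(`le_hilbertFn_sliceIdeal`). This is where bd-1 comes from.

(3) h_d(t) + g_{d+1}(t+2) ≤ h_{d+1}(t+2). The quadric is smooth at each point, so division by Q
lowers the order of vanishing by at most one and I_X^(d+1) : Q lies in I_X^(d); then count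
dimensions (`hilbertFn_fatIdeal_succ_ge`).

By induction on d and Pascal's rule C(d+3,3) = C(d+2,3) + C(d+2,2), the upper bound meets the sum of
the lower bounds, so all are equalities (`hilbertFn_of_gridFrame`). The degree drop 2 in (3) is
affordable because b ≥ 2. The equalities hold for all t ≥ bd-1, so the common value is the
multiplicity.

The coordinates come from two lines of each ruling: their four intersection points, suitably scaled,
form a basis in which Q = c(x₀x₃ - x₁x₂). A further change of basis gives every grid point finite
parameters (α_i, β_j) (`IsGrid.exists_frame`). -/

/-- The `i`-th coordinate with respect to the basis `w`, as a linear form. -/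
noncomputable def dualForm {k : Type*} [Field k] (w : Module.Basis (Fin 4) k (Fin 4 → k))
    (i : Fin 4) : MvPolynomial (Fin 4) k :=
  ∑ j, C (w.repr (Pi.single j 1) i) * X j

/-- The ideal of linear forms vanishing at the first vector of the basis `w`. -/
noncomputable def frameIdeal {k : Type*} [Field k] (w : Module.Basis (Fin 4) k (Fin 4 → k)) :
    Ideal (MvPolynomial (Fin 4) k) :=
  Ideal.span (Set.range fun i : Fin 3 => dualForm w i.succ)

/-- The expansion of a polynomial around the line spanned by the first vector of the basis `w`:
the other three coordinates are multiplied by a new variable. -/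
noncomputable def frameExpand {k : Type*} [Field k] (w : Module.Basis (Fin 4) k (Fin 4 → k)) :
    MvPolynomial (Fin 4) k →ₐ[k] Polynomial (MvPolynomial (Fin 4) k) :=
  aeval fun j => Polynomial.C (C (w 0 j) * dualForm w 0) +
    Polynomial.X * Polynomial.C (∑ i : Fin 3, C (w i.succ j) * dualForm w i.succ)

/-! ### Order of vanishing at one point, and powers of its ideal. -/

section Frame

variable {k : Type*} [Field k] (w : Module.Basis (Fin 4) k (Fin 4 → k))

lemma dualForm_succ_mem_frameIdeal (i : Fin 3) : dualForm w i.succ ∈ frameIdeal w :=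
  Ideal.subset_span ⟨i, rfl⟩

lemma dualForm_mem_idealOfVars (i : Fin 4) : dualForm w i ∈ idealOfVars (Fin 4) k :=
  sum_mem fun j _ => Ideal.mul_mem_left _ _ (Ideal.subset_span ⟨j, rfl⟩)

lemma dualForm_isHomogeneous (i : Fin 4) : (dualForm w i).IsHomogeneous 1 :=
  IsHomogeneous.sum _ _ _ fun j _ => by
    simpa using (isHomogeneous_X k j).C_mul (w.repr (Pi.single j 1) i)

lemma eval_dualForm (i : Fin 4) (v : Fin 4 → k) : eval v (dualForm w i) = w.repr v i := by
  have h : v = ∑ j, v j • (Pi.single j 1 : Fin 4 → k) := by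
    simpa using (pi_eq_sum_univ' v)
  conv_rhs => rw [h]
  simp [dualForm, mul_comm]

lemma X_eq_sum_dualForm [Infinite k] (j : Fin 4) :
    (X j : MvPolynomial (Fin 4) k) = ∑ i, C (w i j) * dualForm w i := by
  apply MvPolynomial.funext
  intro v
  have := congrFun (w.sum_repr v) j
  simp only [Finset.sum_apply, Pi.smul_apply, smul_eq_mul] at this
  simp [eval_dualForm, ← this, mul_comm]

lemma aeval_dualForm_aeval [Infinite k] (f : MvPolynomial (Fin 4) k) :
    aeval (dualForm w) (aeval (fun j => ∑ i, C (w i j) * X i : Fin 4 → MvPolynomial (Fin 4) k) f)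
      = f := by
  have : (aeval (dualForm w)).comp
      (aeval (fun j => ∑ i, C (w i j) * X i : Fin 4 → MvPolynomial (Fin 4) k)) =
      AlgHom.id k _ := by
    ext1 j
    simpa [algebraMap_eq] using (X_eq_sum_dualForm w j).symm
  exact DFunLike.congr_fun this f

/-- Setting the expansion variable to 1 recovers the polynomial, so this control of the coefficients
turns divisibility of the expansion by `X ^ d` into membership in the `d`-th power of the point
ideal. -/
lemma frameExpand_mem_reesAlgebra (f : MvPolynomial (Fin 4) k) :
    frameExpand w f ∈ reesAlgebra (frameIdeal w) := by
  induction f using MvPolynomial.induction_on with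
  | C a =>
    have : frameExpand w (C a) = algebraMap (MvPolynomial (Fin 4) k) _ (C a) := by
      simp [algebraMap_eq]
    rw [this]
    exact Subalgebra.algebraMap_mem _ _
  | add p q hp hq => rw [map_add]; exact add_mem hp hq
  | mul_X p i hp =>
    rw [map_mul]
    refine mul_mem hp ?_
    simp only [frameExpand, aeval_X]
    refine add_mem (Subalgebra.algebraMap_mem _ _) ?_
    rw [Polynomial.X_mul_C, Polynomial.C_mul_X_eq_monomial]
    rw [reesAlgebra.monomial_mem, pow_one]
    exact sum_mem fun i _ => Ideal.mul_mem_left _ _ (dualForm_succ_mem_frameIdeal w i)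

lemma eval_one_frameExpand [Infinite k] (f : MvPolynomial (Fin 4) k) :
    (frameExpand w f).eval 1 = f := by
  have : ((Polynomial.aeval (R := MvPolynomial (Fin 4) k)
      (1 : MvPolynomial (Fin 4) k)).restrictScalars k).comp (frameExpand w) = AlgHom.id k _ := by
    ext1 j
    have := X_eq_sum_dualForm w j
    rw [Fin.sum_univ_succ] at this
    simpa [frameExpand, Polynomial.eval_finsetSum] using this.symm
  simpa using DFunLike.congr_fun this f

lemma mem_frameIdeal_pow_of_dvd [Infinite k] {f : MvPolynomial (Fin 4) k} {d : ℕ}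
    (h : Polynomial.X ^ d ∣ frameExpand w f) : f ∈ frameIdeal w ^ d := by
  rw [← eval_one_frameExpand w f, Polynomial.eval_eq_sum]
  refine sum_mem fun e _ => ?_
  rcases lt_or_ge e d with he | he
  · simp [Polynomial.X_pow_dvd_iff.1 h e he]
  · simp only [one_pow, mul_one]
    exact Ideal.pow_le_pow_right he ((mem_reesAlgebra_iff _ _).1 (frameExpand_mem_reesAlgebra w f) e)

lemma eval_coeff_zero_frameExpand (f : MvPolynomial (Fin 4) k) (v : Fin 4 → k) :
    eval v ((frameExpand w f).coeff 0) = eval (w.repr v 0 • w 0) f := by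
  have : (aeval v).comp (((Polynomial.aeval (R := MvPolynomial (Fin 4) k)
      (0 : MvPolynomial (Fin 4) k)).restrictScalars k).comp (frameExpand w)) =
      aeval (w.repr v 0 • w 0) := by
    ext1 j
    simp [frameExpand, aeval_eq_eval, eval_dualForm, mul_comm]
  have := DFunLike.congr_fun this f
  simpa [aeval_eq_eval, Polynomial.coeff_zero_eq_eval_zero, Polynomial.aeval_def] using this

lemma X_dvd_frameExpand [Infinite k] {f : MvPolynomial (Fin 4) k}
    (h : ∀ c : k, eval (c • w 0) f = 0) : Polynomial.X ∣ frameExpand w f := by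
  rw [Polynomial.X_dvd_iff]
  exact MvPolynomial.funext fun v => by rw [eval_coeff_zero_frameExpand, h, map_zero]

lemma not_X_dvd_frameExpand_dualForm :
    ¬ Polynomial.X ∣ frameExpand w (dualForm w 0) := by
  rw [Polynomial.X_dvd_iff]
  intro h
  have := eval_coeff_zero_frameExpand w (dualForm w 0) (w 0)
  simp [h, eval_dualForm] at this

/-- The expansion variable is prime, so orders of vanishing add; a factor of order at most one can
absorb only one power. -/
lemma X_pow_dvd_frameExpand_of_mul {Q f : MvPolynomial (Fin 4) k} {d : ℕ}
    (hQ : ¬ Polynomial.X ^ 2 ∣ frameExpand w Q)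
    (h : Polynomial.X ^ (d + 1) ∣ frameExpand w (Q * f)) :
    Polynomial.X ^ d ∣ frameExpand w f := by
  have hp : Prime (Polynomial.X : Polynomial (MvPolynomial (Fin 4) k)) := Polynomial.prime_X
  rw [map_mul] at h
  by_cases hX : Polynomial.X ∣ frameExpand w Q
  · obtain ⟨q, hq⟩ := hX
    rw [hq, pow_succ', mul_assoc] at h
    refine hp.pow_dvd_of_dvd_mul_left _ ?_ ((mul_dvd_mul_iff_left hp.ne_zero).1 h)
    rintro ⟨r, rfl⟩
    exact hQ ⟨r, by rw [hq]; ring⟩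
  · exact (pow_dvd_pow _ d.le_succ).trans (hp.pow_dvd_of_dvd_mul_left _ hX h)

lemma exists_coeff_aeval_dualForm [Infinite k] {f : MvPolynomial (Fin 4) k} {t : ℕ}
    (hf : f.IsHomogeneous t) :
    ∃ g : MvPolynomial (Fin 4) k, g.IsHomogeneous t ∧ f = aeval (dualForm w) g := by
  refine ⟨_, ?_, (aeval_dualForm_aeval w f).symm⟩
  simpa using hf.aeval (n := 1) (fun j => ∑ i, C (w i j) * X i : Fin 4 → MvPolynomial (Fin 4) k)
    (fun j => IsHomogeneous.sum _ _ _ fun i _ => by simpa using (isHomogeneous_X k i).C_mul (w i j))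

lemma prod_dualForm_mem_frameIdeal_pow (γ : Fin 4 →₀ ℕ) :
    ∏ i : Fin 3, dualForm w i.succ ^ γ i.succ ∈ frameIdeal w ^ (∑ i : Fin 3, γ i.succ) := by
  rw [← Finset.prod_pow_eq_pow_sum]
  exact Ideal.prod_mem_prod (I := fun i : Fin 3 => frameIdeal w ^ γ i.succ)
    fun i _ => Ideal.pow_mem_pow (dualForm_succ_mem_frameIdeal w i) _

/-- A form of degree `t` is, modulo the `(d + 1)`-st power of the ideal of a point, a combination of
the monomials of degree at most `d` in the linear forms vanishing at that point. -/
lemma mem_span_sup_frameIdeal_pow [Infinite k] {f : MvPolynomial (Fin 4) k} {t : ℕ}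
    (hf : f.IsHomogeneous t) (d : ℕ) :
    f ∈ Submodule.span k ((fun γ : Fin 4 →₀ ℕ => dualForm w 0 ^ (t + γ 0 - d) *
      ∏ i : Fin 3, dualForm w i.succ ^ γ i.succ) ''
        ((Finset.univ : Finset (Fin 4)).finsuppAntidiag d)) ⊔
      (frameIdeal w ^ (d + 1)).restrictScalars k := by
  obtain ⟨g, hgh, rfl⟩ := exists_coeff_aeval_dualForm w hf
  rw [g.as_sum, map_sum]
  refine sum_mem fun γ hγ => ?_
  have hdeg : γ 0 + ∑ i : Fin 3, γ i.succ = t := by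
    rw [hgh.degree_eq_sum_deg_support hγ, ← Fin.sum_univ_succ (fun i => γ i)]
    exact (Finsupp.degree_eq_sum γ).symm
  rw [aeval_monomial, ← Algebra.smul_def]
  refine Submodule.smul_mem _ _ ?_
  rw [Finsupp.prod_fintype _ _ (fun _ => pow_zero _), Fin.prod_univ_succ]
  rcases le_or_gt (∑ i : Fin 3, γ i.succ) d with hle | hlt
  · refine Submodule.mem_sup_left (Submodule.subset_span ?_)
    -- The entry at 0 is a slack variable filling the total up to `d`, so that the index set does
    -- not depend on `t`. For small `t` the truncated exponents only add superfluous generators.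
    refine ⟨Finsupp.equivFunOnFinite.symm
      (Fin.cons (d - ∑ i : Fin 3, γ i.succ) fun i => γ i.succ), ?_, ?_⟩
    · rw [Finset.mem_coe, Finset.mem_finsuppAntidiag]
      refine ⟨?_, Finset.subset_univ _⟩
      rw [Fin.sum_univ_succ]
      simp only [Finsupp.equivFunOnFinite_symm_apply_apply, Fin.cons_zero, Fin.cons_succ]
      omega
    · have : t + (d - ∑ i : Fin 3, γ i.succ) - d = γ 0 := by omega
      simp only [Finsupp.equivFunOnFinite_symm_apply_apply, Fin.cons_zero, Fin.cons_succ, this]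
  · refine Submodule.mem_sup_right ?_
    exact Ideal.mul_mem_left _ _
      (Ideal.pow_le_pow_right hlt (prod_dualForm_mem_frameIdeal_pow w γ))

lemma card_finsuppAntidiag_fin_four (d : ℕ) :
    ((Finset.univ : Finset (Fin 4)).finsuppAntidiag d).card = (d + 3).choose 3 := by
  have : (Finset.univ : Finset (Fin 4)).card + d - 1 = d + 3 := by
    rw [Finset.card_univ, Fintype.card_fin]; omega
  rw [Finset.card_finsuppAntidiag_nat_eq_choose, this, Nat.choose_symm_add]

lemma hilbertFn_frameIdeal_pow_le [Infinite k] (d t : ℕ) :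
    hilbertFn (frameIdeal w ^ d) t ≤ (d + 2).choose 3 := by
  classical
  rcases d with _ | d
  · have : Subsingleton (MvPolynomial (Fin 4) k ⧸ frameIdeal w ^ 0) := by
      rw [pow_zero, Ideal.one_eq_top]; exact Ideal.Quotient.subsingleton_iff.2 rfl
    have h0 := Module.finrank_zero_of_subsingleton (R := k)
      (M := (homogeneousSubmodule (Fin 4) k t).map
        (Ideal.Quotient.mkₐ k (frameIdeal w ^ 0)).toLinearMap)
    rw [hilbertFn, h0]
    exact Nat.zero_le _
  let mon : (Fin 4 →₀ ℕ) → MvPolynomial (Fin 4) k := fun γ => dualForm w 0 ^ (t + γ 0 - d) *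
      ∏ i : Fin 3, dualForm w i.succ ^ γ i.succ
  let S : Finset (MvPolynomial (Fin 4) k ⧸ frameIdeal w ^ (d + 1)) :=
    ((Finset.univ : Finset (Fin 4)).finsuppAntidiag d).image
      fun γ => Ideal.Quotient.mkₐ k (frameIdeal w ^ (d + 1)) (mon γ)
  have hS : S.card ≤ (d + 1 + 2).choose 3 :=
    Finset.card_image_le.trans (card_finsuppAntidiag_fin_four d).le
  refine le_trans ?_ ((finrank_span_finset_le_card (R := k) S).trans hS)
  refine Submodule.finrank_mono ?_
  rintro _ ⟨f, hf, rfl⟩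
  obtain ⟨x, hx, y, hy, rfl⟩ := Submodule.mem_sup.1 (mem_span_sup_frameIdeal_pow w hf d)
  have hy0 : (Ideal.Quotient.mkₐ k (frameIdeal w ^ (d + 1))) y = 0 :=
    Ideal.Quotient.eq_zero_iff_mem.2 hy
  rw [AlgHom.toLinearMap_apply, map_add, hy0, add_zero]
  have := Submodule.mem_map_of_mem (f := (Ideal.Quotient.mkₐ k (frameIdeal w ^ (d + 1))).toLinearMap) hx
  rw [Submodule.map_span, ← Set.image_comp] at this
  simpa [S, mon, Function.comp_def] using this

end Frame

/-! ### Saturation, and dimension counts for Hilbert functions. -/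

section Saturation

variable {k : Type*} [Field k]

lemma le_satIdeal (I : Ideal (MvPolynomial (Fin 4) k)) : I ≤ satIdeal I :=
  fun _ hf => ⟨0, fun g _ => I.mul_mem_left g hf⟩

lemma exists_pow_mul_mem_of_mem_satIdeal {I : Ideal (MvPolynomial (Fin 4) k)}
    {f s : MvPolynomial (Fin 4) k} (hf : f ∈ satIdeal I) (hs : s ∈ idealOfVars (Fin 4) k) :
    ∃ N : ℕ, s ^ N * f ∈ I :=
  hf.imp fun _ hN => hN _ (Ideal.pow_mem_pow hs _)

/-- Saturation is harmless as soon as one element of the irrelevant ideal acts injectively modulo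
`J`. Below, that element is the coordinate `dualForm w 0`, which does not vanish at the point
considered. -/
lemma satIdeal_le_comap {I : Ideal (MvPolynomial (Fin 4) k)} {S : Type*} [CommRing S]
    (φ : MvPolynomial (Fin 4) k →+* S) {J : Ideal S} (hI : I ≤ J.comap φ)
    {s : MvPolynomial (Fin 4) k} (hs : s ∈ idealOfVars (Fin 4) k)
    (hJ : ∀ (N : ℕ) (x : S), φ s ^ N * x ∈ J → x ∈ J) : satIdeal I ≤ J.comap φ := by
  intro f hf
  obtain ⟨N, hN⟩ := exists_pow_mul_mem_of_mem_satIdeal hf hs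
  have := hI hN
  rw [Ideal.mem_comap, map_mul, map_pow] at this
  exact hJ N _ this

lemma mem_satIdeal_of_le_radical {I J : Ideal (MvPolynomial (Fin 4) k)}
    {f : MvPolynomial (Fin 4) k} (hJ : idealOfVars (Fin 4) k ≤ J.radical)
    (h : ∀ g ∈ J, g * f ∈ I) : f ∈ satIdeal I := by
  obtain ⟨N, hN⟩ := Ideal.exists_pow_le_of_le_radical_of_fg hJ (idealOfVars_fg _ _)
  exact ⟨N, fun g hg => h g (hN hg)⟩

instance (t : ℕ) : Module.Finite k (homogeneousSubmodule (Fin 4) k t) :=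
  Module.Finite.iff_fg.2 (homogeneousSubmodule_fg _ _ t)

lemma finrank_map_add_finrank_inf_ker {E F : Type*} [AddCommGroup E] [Module k E]
    [AddCommGroup F] [Module k F] (V : Submodule k E) [Module.Finite k V] (g : E →ₗ[k] F) :
    Module.finrank k (V.map g) + Module.finrank k (V ⊓ LinearMap.ker g : Submodule k E) =
      Module.finrank k V := by
  have h := (g.domRestrict V).finrank_range_add_finrank_ker
  rw [LinearMap.range_domRestrict] at h
  rw [← h]
  congr 1
  refine LinearEquiv.finrank_eq (LinearEquiv.symm ?_)
  refine (Submodule.equivMapOfInjective V.subtype V.injective_subtype _).trans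
    (LinearEquiv.ofEq _ _ ?_)
  ext x
  simp [and_comm]

/-- The Hilbert function and the dimension of the graded piece of the ideal add up to the dimension
of the space of forms. -/
lemma hilbertFn_add_finrank (I : Ideal (MvPolynomial (Fin 4) k)) (t : ℕ) :
    hilbertFn I t + Module.finrank k
      (homogeneousSubmodule (Fin 4) k t ⊓ I.restrictScalars k : Submodule k _) =
      Module.finrank k (homogeneousSubmodule (Fin 4) k t) := by
  have : I.restrictScalars k = LinearMap.ker (Ideal.Quotient.mkₐ k I).toLinearMap :=
    Submodule.ext fun x => Ideal.Quotient.eq_zero_iff_mem.symm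
  rw [this]
  exact finrank_map_add_finrank_inf_ker _ _

lemma finrank_le_sum_of_forall_apply_mem {ι : Type*} [Fintype ι] {M : ι → Type*}
    [∀ i, AddCommGroup (M i)] [∀ i, Module k (M i)] (S : Submodule k (∀ i, M i))
    (W : ∀ i, Submodule k (M i)) [∀ i, Module.Finite k (W i)] (h : ∀ x ∈ S, ∀ i, x i ∈ W i) :
    Module.finrank k S ≤ ∑ i, Module.finrank k (W i) := by
  rw [← Module.finrank_pi_fintype k]
  let G : S →ₗ[k] ∀ i, W i := LinearMap.pi fun i =>
    ((LinearMap.proj i).domRestrict S).codRestrict (W i) fun x => h x x.2 i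
  refine LinearMap.finrank_le_finrank_of_injective (f := G) fun x y hxy => ?_
  ext i
  exact congrArg Subtype.val (congrFun hxy i)

lemma finrank_map_le_hilbertFn {E : Type*} [AddCommGroup E] [Module k E]
    (I : Ideal (MvPolynomial (Fin 4) k)) (t : ℕ) (L : MvPolynomial (Fin 4) k →ₗ[k] E)
    (hL : ∀ f ∈ I, L f = 0) :
    Module.finrank k ((homogeneousSubmodule (Fin 4) k t).map L) ≤ hilbertFn I t := by
  let M : (MvPolynomial (Fin 4) k ⧸ I) →ₗ[k] E := (I.restrictScalars k).liftQ L hL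
  have hM : L = M.comp (Ideal.Quotient.mkₐ k I).toLinearMap := by
    ext f; rfl
  rw [hM, Submodule.map_comp, hilbertFn]
  exact Submodule.finrank_map_le _ _

lemma hilbertFn_le_sum {ι : Type*} [Fintype ι] {I : Ideal (MvPolynomial (Fin 4) k)}
    (J : ι → Ideal (MvPolynomial (Fin 4) k)) (h : ⨅ i, J i ≤ I) (t : ℕ) :
    hilbertFn I t ≤ ∑ i, hilbertFn (J i) t := by
  set V := homogeneousSubmodule (Fin 4) k t with hV
  let L : MvPolynomial (Fin 4) k →ₗ[k] ∀ i, MvPolynomial (Fin 4) k ⧸ J i :=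
    LinearMap.pi fun i => (Ideal.Quotient.mkₐ k (J i)).toLinearMap
  have h1 := finrank_map_add_finrank_inf_ker V L
  have h2 : Module.finrank k (V.map L) ≤ ∑ i, hilbertFn (J i) t := by
    refine finrank_le_sum_of_forall_apply_mem _
      (fun i => V.map (Ideal.Quotient.mkₐ k (J i)).toLinearMap) ?_
    rintro _ ⟨f, hf, rfl⟩ i
    exact ⟨f, hf, rfl⟩
  have h3 := hilbertFn_add_finrank I t
  have h4 : Module.finrank k (V ⊓ LinearMap.ker L : Submodule k _) ≤ Module.finrank k
      (V ⊓ I.restrictScalars k : Submodule k _) := by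
    have : Module.Finite k (V ⊓ I.restrictScalars k : Submodule k _) :=
      Submodule.finiteDimensional_inf_left _ _
    refine Submodule.finrank_mono (inf_le_inf_left V fun f hf => h ?_)
    rw [Ideal.mem_iInf]
    exact fun i => Ideal.Quotient.eq_zero_iff_mem.1 (congrFun hf i)
  rw [← hV] at h3
  omega

/-- The inequality of Hilbert functions given by multiplication by a quadratic form `Q`. -/
lemma hilbertFn_add_le_of_colon {I J K : Ideal (MvPolynomial (Fin 4) k)}
    {Q : MvPolynomial (Fin 4) k} (hQ : Q.IsHomogeneous 2) (hQ0 : Q ≠ 0)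
    (hIK : I ≤ K) (hQK : Q ∈ K) (hJ : ∀ f, Q * f ∈ I → f ∈ J) (t : ℕ) :
    hilbertFn J t + hilbertFn K (t + 2) ≤ hilbertFn I (t + 2) := by
  let V := homogeneousSubmodule (Fin 4) k t
  let V' := homogeneousSubmodule (Fin 4) k (t + 2)
  let m := LinearMap.mulLeft k Q
  have hm : Function.Injective m := fun f g h => mul_left_cancel₀ hQ0 h
  let A : Submodule k (MvPolynomial (Fin 4) k) := V' ⊓ I.restrictScalars k
  have : Module.Finite k A := Submodule.finiteDimensional_inf_left _ _
  have : Module.Finite k (V' ⊓ K.restrictScalars k : Submodule k _) :=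
    Submodule.finiteDimensional_inf_left _ _
  have : Module.Finite k (V ⊓ J.restrictScalars k : Submodule k _) :=
    Submodule.finiteDimensional_inf_left _ _
  -- With R the polynomial ring, I_{t+2} + Q·R_t lies in K_{t+2} and I_{t+2} ∩ Q·R_t lies in Q·J_t.
  -- Hence dim I_{t+2} + dim R_t ≤ dim K_{t+2} + dim J_t.
  have h1 := Submodule.finrank_sup_add_finrank_inf_eq A (V.map m)
  have h2 : Module.finrank k (A ⊔ V.map m : Submodule k _) ≤
      Module.finrank k (V' ⊓ K.restrictScalars k : Submodule k _) := by
    refine Submodule.finrank_mono (sup_le (inf_le_inf_left _ hIK) ?_)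
    rintro _ ⟨f, hf, rfl⟩
    refine ⟨?_, K.mul_mem_right f hQK⟩
    have : (Q * f).IsHomogeneous (2 + t) := hQ.mul hf
    rwa [add_comm] at this
  have h3 : Module.finrank k (A ⊓ V.map m : Submodule k _) ≤
      Module.finrank k (V ⊓ J.restrictScalars k : Submodule k _) := by
    refine (Submodule.finrank_mono ?_).trans (Submodule.finrank_map_le m _)
    rintro _ ⟨⟨-, hI⟩, f, hf, rfl⟩
    exact ⟨f, ⟨hf, hJ f hI⟩, rfl⟩
  have h4 : Module.finrank k (V.map m) = Module.finrank k V :=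
    (LinearEquiv.finrank_eq (Submodule.equivMapOfInjective m hm V)).symm
  have h5 := hilbertFn_add_finrank I (t + 2)
  have h6 := hilbertFn_add_finrank J t
  have h7 := hilbertFn_add_finrank K (t + 2)
  simp only [A, V, V'] at *
  omega

end Saturation

/-! ### Fat points at a finite set with separating forms. -/

section Points

variable {k : Type*} [Field k] {ι : Type*} {w : ι → Module.Basis (Fin 4) k (Fin 4 → k)}
  {X : Set (P3 k)}

/-- `X` is the set of points spanned by the first vectors of the bases `w i`. -/
def IsPointSet {k : Type*} [Field k] {ι : Type*} (w : ι → Module.Basis (Fin 4) k (Fin 4 → k))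
    (X : Set (P3 k)) : Prop :=
  ∀ f : MvPolynomial (Fin 4) k,
    (∀ P ∈ X, ∀ v ∈ P.submodule, eval v f = 0) ↔ ∀ i, ∀ c : k, eval (c • w i 0) f = 0

lemma pointsIdeal_le_comap (hX : IsPointSet w X) (i : ι) {S : Type*} [CommRing S]
    (φ : MvPolynomial (Fin 4) k →+* S) {J : Ideal S}
    (h : ∀ f, (∀ c : k, eval (c • w i 0) f = 0) → φ f ∈ J) : pointsIdeal X ≤ J.comap φ :=
  Ideal.span_le.2 fun f hf => h f ((hX f).1 hf.2 i)

lemma MvPolynomial.IsHomogeneous.eval_smul {σ : Type*} [Fintype σ] {f : MvPolynomial σ k}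
    {t : ℕ} (hf : f.IsHomogeneous t) (c : k) (v : σ → k) : eval (c • v) f = c ^ t * eval v f := by
  rw [eval_eq', eval_eq', Finset.mul_sum]
  refine Finset.sum_congr rfl fun γ hγ => ?_
  have : ∑ i, γ i = t := by
    rw [hf.degree_eq_sum_deg_support hγ]
    exact (Finsupp.degree_eq_sum γ).symm
  simp only [Pi.smul_apply, smul_eq_mul, mul_pow, Finset.prod_mul_distrib,
    Finset.prod_pow_eq_pow_sum, this]
  ring

lemma mem_pointsIdeal (hX : IsPointSet w X) {f : MvPolynomial (Fin 4) k} {t : ℕ}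
    (hf : f.IsHomogeneous t) (h : ∀ i, eval (w i 0) f = 0) : f ∈ pointsIdeal X := by
  refine Ideal.subset_span ⟨⟨t, hf⟩, (hX f).2 fun i c => ?_⟩
  rw [hf.eval_smul, h i, mul_zero]

/-- Forms vanishing on `X` have order at least one at each point, hence their `d`-fold products
order at least `d`. Saturation does not lower this, since `dualForm (w i) 0` has order zero there.
-/
lemma X_pow_dvd_of_mem_fatIdeal [Infinite k] (hX : IsPointSet w X) (i : ι) {d : ℕ}
    {f : MvPolynomial (Fin 4) k} (hf : f ∈ fatIdeal X d) :
    Polynomial.X ^ d ∣ frameExpand (w i) f := by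
  have hp : Prime (Polynomial.X : Polynomial (MvPolynomial (Fin 4) k)) := Polynomial.prime_X
  have h1 : pointsIdeal X ≤ (Ideal.span {Polynomial.X}).comap (frameExpand (w i)).toRingHom :=
    pointsIdeal_le_comap hX i _ fun f hf => Ideal.mem_span_singleton.2 (X_dvd_frameExpand _ hf)
  have h2 : pointsIdeal X ^ d ≤
      (Ideal.span {Polynomial.X ^ d}).comap (frameExpand (w i)).toRingHom := by
    rw [← Ideal.span_singleton_pow]
    exact (Ideal.pow_right_mono h1 d).trans (Ideal.le_comap_pow _ d)
  refine Ideal.mem_span_singleton.1 (satIdeal_le_comap _ h2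
    (dualForm_mem_idealOfVars (w i) 0) (fun N x hx => ?_) hf)
  rw [Ideal.mem_span_singleton] at hx ⊢
  exact hp.pow_dvd_of_dvd_mul_left _
    (fun h => not_X_dvd_frameExpand_dualForm (w i) (hp.dvd_of_dvd_pow h)) hx

variable {s : ι → MvPolynomial (Fin 4) k} {n : ℕ}

/-- The `n`-th power of a variable minus its interpolant by the separators vanishes on `X`. The
common degree `n` of the separators keeps this difference homogeneous. -/
lemma idealOfVars_le_radical [Fintype ι] (hX : IsPointSet w X) (hs : ∀ i, (s i).IsHomogeneous n)
    (hsi : ∀ i, eval (w i 0) (s i) ≠ 0) (hsj : ∀ i j, i ≠ j → eval (w j 0) (s i) = 0) :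
    idealOfVars (Fin 4) k ≤ (pointsIdeal X ⊔ Ideal.span (Set.range s)).radical := by
  refine Ideal.span_le.2 ?_
  rintro _ ⟨j, rfl⟩
  refine ⟨n, ?_⟩
  have hh : ((MvPolynomial.X j : MvPolynomial (Fin 4) k) ^ n).IsHomogeneous n := isHomogeneous_X_pow j n
  set c : ι → k := fun i => eval (w i 0) (MvPolynomial.X j ^ n) / eval (w i 0) (s i) with hc
  rw [← sub_add_cancel (MvPolynomial.X j ^ n) (∑ i, C (c i) * s i)]
  refine add_mem (Ideal.mem_sup_left (mem_pointsIdeal hX (t := n) ?_ fun i => ?_))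
    (Ideal.mem_sup_right (sum_mem fun i _ => Ideal.mul_mem_left _ _ (Ideal.subset_span ⟨i, rfl⟩)))
  · exact hh.sub (IsHomogeneous.sum _ _ _ fun i _ => (hs i).C_mul _)
  · rw [map_sub, map_sum, Finset.sum_eq_single i]
    · rw [map_mul, eval_C, div_mul_cancel₀ _ (hsi i), sub_self]
    · intro j _ hj
      rw [map_mul, hsj j i hj, mul_zero]
    · simp

lemma mul_mem_pointsIdeal (hX : IsPointSet w X) (hs : ∀ i, (s i).IsHomogeneous n)
    (hsj : ∀ i j, i ≠ j → eval (w j 0) (s i) = 0) (i : ι) {f : MvPolynomial (Fin 4) k}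
    (hf : f ∈ frameIdeal (w i)) : s i * f ∈ pointsIdeal X := by
  classical
  induction hf using Submodule.span_induction with
  | mem f hf =>
    obtain ⟨l, rfl⟩ := hf
    refine mem_pointsIdeal hX ((hs i).mul (dualForm_isHomogeneous (w i) l.succ)) fun j => ?_
    rw [map_mul]
    by_cases h : i = j
    · subst h
      simp [eval_dualForm]
    · rw [hsj i j h, zero_mul]
  | zero => simp
  | add f g _ _ hf hg => rw [mul_add]; exact add_mem hf hg
  | smul c f _ hf => rw [smul_eq_mul, mul_left_comm]; exact Ideal.mul_mem_left _ _ hf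

/-- The separator `s i` carries the ideal of its point into I_X, so `s i ^ d` carries the `d`-th
power into I_X^d. Together with I_X^d, these powers generate an ideal whose radical contains the
irrelevant ideal, which is enough for the saturation. -/
lemma iInf_frameIdeal_pow_le_fatIdeal [Fintype ι] (hX : IsPointSet w X)
    (hs : ∀ i, (s i).IsHomogeneous n) (hsi : ∀ i, eval (w i 0) (s i) ≠ 0)
    (hsj : ∀ i j, i ≠ j → eval (w j 0) (s i) = 0) (d : ℕ) :
    ⨅ i, frameIdeal (w i) ^ d ≤ fatIdeal X d := by
  intro f hf
  rw [Ideal.mem_iInf] at hf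
  let J := pointsIdeal X ^ d ⊔ Ideal.span (Set.range fun i => s i ^ d)
  refine mem_satIdeal_of_le_radical (J := J) ?_ fun g hg => ?_
  · refine (idealOfVars_le_radical hX hs hsi hsj).trans ?_
    rw [Ideal.radical_le_radical_iff]
    refine sup_le (fun g hg => ⟨d, Ideal.mem_sup_left (Ideal.pow_mem_pow hg d)⟩) ?_
    rw [Ideal.span_le]
    rintro _ ⟨i, rfl⟩
    exact ⟨d, Ideal.mem_sup_right (Ideal.subset_span ⟨i, rfl⟩)⟩
  · have : J ≤ Submodule.comap (LinearMap.toSpanSingleton (MvPolynomial (Fin 4) k) _ f)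
        (pointsIdeal X ^ d) := by
      refine sup_le (fun g hg => Ideal.mul_mem_right _ _ hg) (Ideal.span_le.2 ?_)
      rintro _ ⟨i, rfl⟩
      have h : Ideal.span {s i} * frameIdeal (w i) ≤ pointsIdeal X :=
        Ideal.span_singleton_mul_le_iff.2 fun f hf => mul_mem_pointsIdeal hX hs hsj i hf
      have := Ideal.pow_right_mono h d
      rw [mul_pow, Ideal.span_singleton_pow, Ideal.span_singleton_mul_le_iff] at this
      exact this f (hf i)
    exact this hg

lemma mem_fatIdeal_of_mul_mem [Infinite k] [Fintype ι] (hX : IsPointSet w X)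
    (hs : ∀ i, (s i).IsHomogeneous n) (hsi : ∀ i, eval (w i 0) (s i) ≠ 0)
    (hsj : ∀ i j, i ≠ j → eval (w j 0) (s i) = 0) {Q : MvPolynomial (Fin 4) k}
    (hQ : ∀ i, ¬ Polynomial.X ^ 2 ∣ frameExpand (w i) Q) {d : ℕ} {f : MvPolynomial (Fin 4) k}
    (hf : Q * f ∈ fatIdeal X (d + 1)) : f ∈ fatIdeal X d :=
  iInf_frameIdeal_pow_le_fatIdeal hX hs hsi hsj d <| Ideal.mem_iInf.2 fun i =>
    mem_frameIdeal_pow_of_dvd _ <|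
      X_pow_dvd_frameExpand_of_mul _ (hQ i) (X_pow_dvd_of_mem_fatIdeal hX i hf)

lemma hilbertFn_fatIdeal_le [Infinite k] [Fintype ι] (hX : IsPointSet w X)
    (hs : ∀ i, (s i).IsHomogeneous n) (hsi : ∀ i, eval (w i 0) (s i) ≠ 0)
    (hsj : ∀ i j, i ≠ j → eval (w j 0) (s i) = 0) (d t : ℕ) :
    hilbertFn (fatIdeal X d) t ≤ Fintype.card ι * (d + 2).choose 3 := by
  refine (hilbertFn_le_sum _ (iInf_frameIdeal_pow_le_fatIdeal hX hs hsi hsj d) t).trans ?_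
  refine (Finset.sum_le_sum fun i _ => hilbertFn_frameIdeal_pow_le (w i) d t).trans ?_
  simp

lemma hilbertFn_fatIdeal_succ_ge [Infinite k] [Fintype ι] (hX : IsPointSet w X)
    (hs : ∀ i, (s i).IsHomogeneous n) (hsi : ∀ i, eval (w i 0) (s i) ≠ 0)
    (hsj : ∀ i j, i ≠ j → eval (w j 0) (s i) = 0) {Q : MvPolynomial (Fin 4) k}
    (hQ2 : Q.IsHomogeneous 2) (hQ0 : Q ≠ 0)
    (hQ : ∀ i, ¬ Polynomial.X ^ 2 ∣ frameExpand (w i) Q) (d t : ℕ) :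
    hilbertFn (fatIdeal X d) t + hilbertFn (sliceIdeal Q X (d + 1)) (t + 2) ≤
      hilbertFn (fatIdeal X (d + 1)) (t + 2) :=
  hilbertFn_add_le_of_colon hQ2 hQ0 (le_sup_left.trans (le_satIdeal _))
    (le_satIdeal _ (Ideal.mem_sup_right (Ideal.mem_span_singleton_self Q)))
    (fun _ => mem_fatIdeal_of_mul_mem hX hs hsi hsj hQ) t

lemma hilbertFn_antitone {k : Type*} [Field k] {I J : Ideal (MvPolynomial (Fin 4) k)} (h : I ≤ J)
    (t : ℕ) : hilbertFn J t ≤ hilbertFn I t :=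
  finrank_map_le_hilbertFn I t _ fun _ hf => Ideal.Quotient.eq_zero_iff_mem.2 (h hf)

end Points

/-! ### Hermite interpolation in one variable. -/

section Hermite

variable {k : Type*} [Field k]

lemma X_sub_C_pow_dvd_of_taylor_coeff {r : k} {d : ℕ} {G : Polynomial k}
    (h : ∀ e < d, (Polynomial.taylor r G).coeff e = 0) :
    (Polynomial.X - Polynomial.C r) ^ d ∣ G :=
  Polynomial.X_sub_C_pow_dvd_iff.2 (Polynomial.X_pow_dvd_iff.2 h)

/-- Hermite interpolation: prescribed Taylor expansions to order `d` at distinct nodes. -/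
lemma exists_hermite {a : ℕ} {α : Fin a → k} (hα : Function.Injective α) (d : ℕ)
    (y : Fin a × Fin d → k) :
    ∃ G : Polynomial k, G.degree < ((a * d : ℕ) : WithBot ℕ) ∧
      ∀ i, ∀ e : Fin d, (Polynomial.taylor (α i) G).coeff e = y (i, e) := by
  let L : Polynomial.degreeLT k (a * d) →ₗ[k] Fin a × Fin d → k :=
    LinearMap.pi fun ie => (Polynomial.lcoeff k ie.2) ∘ₗ (Polynomial.taylor (α ie.1)) ∘ₗ
      (Polynomial.degreeLT k (a * d)).subtype
  have hinj : Function.Injective L := by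
    rw [← LinearMap.ker_eq_bot, LinearMap.ker_eq_bot']
    rintro ⟨G, hG⟩ h0
    -- A kernel element is divisible by a product of degree `a * d`, so it is zero. Source and
    -- target both have dimension `a * d`, hence injectivity gives surjectivity.
    have hdvd : (∏ i, (Polynomial.X - Polynomial.C (α i)) ^ d) ∣ G := by
      refine Fintype.prod_dvd_of_coprime (fun i j hij => IsCoprime.pow
        (Polynomial.pairwise_coprime_X_sub_C hα hij)) fun i => ?_
      exact X_sub_C_pow_dvd_of_taylor_coeff fun e he => congrFun h0 (i, ⟨e, he⟩)
    have hdeg : (∏ i, (Polynomial.X - Polynomial.C (α i)) ^ d).degree =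
        ((a * d : ℕ) : WithBot ℕ) := by
      rw [Polynomial.degree_prod]
      simp
    have hG0 : G = 0 := Polynomial.eq_zero_of_dvd_of_degree_lt hdvd <| by
      rw [hdeg]; exact Polynomial.mem_degreeLT.1 hG
    subst hG0
    rfl
  have hsurj : Function.Surjective L := by
    have : Module.Finite k (Polynomial.degreeLT k (a * d)) :=
      Module.Finite.equiv (Polynomial.degreeLTEquiv k (a * d)).symm
    refine (LinearMap.injective_iff_surjective_of_finrank_eq_finrank ?_).1 hinj
    rw [(Polynomial.degreeLTEquiv k (a * d)).finrank_eq]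
    simp
  obtain ⟨⟨G, hG⟩, hy⟩ := hsurj y
  exact ⟨G, Polynomial.mem_degreeLT.1 hG, fun i e => congrFun hy (i, e)⟩

lemma natDegree_lt_succ_of_degree_lt {G : Polynomial k} {n t : ℕ}
    (hG : G.degree < ((n : ℕ) : WithBot ℕ)) (hn : n ≤ t + 1) : G.natDegree < t + 1 := by
  rcases eq_or_ne G 0 with rfl | h
  · simp
  · exact ((Polynomial.natDegree_lt_iff_degree_lt h).2 hG).trans_le hn

lemma coeff_aeval_X_mul_aeval_X (G H : Polynomial k) (e f : ℕ) :
    coeff (Finsupp.single 0 e + Finsupp.single 1 f)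
      (Polynomial.aeval (X 0 : MvPolynomial (Fin 2) k) G * Polynomial.aeval (X 1) H) =
      G.coeff e * H.coeff f := by
  induction G using Polynomial.induction_on' with
  | add p q hp hq => simp only [map_add, add_mul, coeff_add, hp, hq, Polynomial.coeff_add]
  | monomial m a =>
    induction H using Polynomial.induction_on' with
    | add p q hp hq => simp only [map_add, mul_add, coeff_add, hp, hq, Polynomial.coeff_add]
    | monomial n b =>
      have h : (Polynomial.aeval (X 0 : MvPolynomial (Fin 2) k) (Polynomial.monomial m a) *
          Polynomial.aeval (X 1) (Polynomial.monomial n b)) =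
          monomial (Finsupp.single 0 m + Finsupp.single 1 n) (a * b) := by
        rw [Polynomial.aeval_monomial, Polynomial.aeval_monomial, X_pow_eq_monomial,
          X_pow_eq_monomial, algebraMap_eq, C_mul_monomial, C_mul_monomial, monomial_mul,
          mul_one, mul_one]
      have h2 : (Finsupp.single (0 : Fin 2) m + Finsupp.single 1 n =
          Finsupp.single 0 e + Finsupp.single 1 f) ↔ m = e ∧ n = f := by
        refine ⟨fun h => ⟨?_, ?_⟩, by rintro ⟨rfl, rfl⟩; rfl⟩
        · simpa using DFunLike.congr_fun h 0
        · simpa using DFunLike.congr_fun h 1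
      rw [h, coeff_monomial, Polynomial.coeff_monomial, Polynomial.coeff_monomial]
      simp only [h2]
      split_ifs <;> simp_all

end Hermite

/-! ### Lower bound on the quadric by bigraded interpolation. -/

/-- The point with parameters `(x, y)` of the quadric surface parametrized by the basis `w`. -/
def gridVec {k : Type*} [Field k] (w : Fin 4 → Fin 4 → k) (x y : k) : Fin 4 → k :=
  w 0 + x • w 1 + y • w 2 + (x * y) • w 3

/-- The expansion of a polynomial on the parametrized quadric around the point `(α, β)`. -/
noncomputable def gridExpand {k : Type*} [Field k] (w : Fin 4 → Fin 4 → k) (α β : k) :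
    MvPolynomial (Fin 4) k →ₐ[k] MvPolynomial (Fin 2) k :=
  aeval fun l => C (w 0 l) + (C α + X 0) * C (w 1 l) + (C β + X 1) * C (w 2 l) +
    (C α + X 0) * (C β + X 1) * C (w 3 l)

section Grid

variable {k : Type*} [Field k] (w : Module.Basis (Fin 4) k (Fin 4 → k)) {a b : ℕ}
  {α : Fin a → k} {β : Fin b → k}

lemma eval_gridExpand (α β : k) (f : MvPolynomial (Fin 4) k) (z : Fin 2 → k) :
    eval z (gridExpand w α β f) = eval (gridVec w (α + z 0) (β + z 1)) f := by
  have : (aeval z).comp (gridExpand w α β) = aeval (gridVec w (α + z 0) (β + z 1)) := by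
    ext1 l
    simp [gridExpand, gridVec, aeval_eq_eval]
  exact DFunLike.congr_fun this f

lemma repr_gridVec (x y : k) (i : Fin 4) : w.repr (gridVec w x y) i = ![1, x, y, x * y] i := by
  fin_cases i <;> simp [gridVec]

lemma gridExpand_dualForm [Infinite k] (α β : k) (i : Fin 4) :
    gridExpand w α β (dualForm w i) =
      (![1, C α + X 0, C β + X 1, (C α + X 0) * (C β + X 1)] : Fin 4 → MvPolynomial (Fin 2) k) i := by
  refine MvPolynomial.funext fun z => ?_
  rw [eval_gridExpand, eval_dualForm, repr_gridVec]
  fin_cases i <;> simp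

/-- On the parametrized chart `dualForm w 0` becomes 1, so both saturations disappear, and `Q`
becomes 0. What remains is that a form vanishing at the point has no constant term. -/
lemma gridExpand_mem_of_mem_sliceIdeal [Infinite k] {X : Set (P3 k)} {Q : MvPolynomial (Fin 4) k}
    {α β : k} (hX : ∀ f : MvPolynomial (Fin 4) k, (∀ P ∈ X, ∀ v ∈ P.submodule, eval v f = 0) →
      eval (gridVec w α β) f = 0)
    (hQ : ∀ x y, eval (gridVec w x y) Q = 0) {d : ℕ} {f : MvPolynomial (Fin 4) k}
    (hf : f ∈ sliceIdeal Q X d) : gridExpand w α β f ∈ idealOfVars (Fin 2) k ^ d := by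
  have h1 : pointsIdeal X ≤ (idealOfVars (Fin 2) k).comap (gridExpand w α β).toRingHom := by
    refine Ideal.span_le.2 fun f hf => ?_
    have : gridExpand w α β f ∈ idealOfVars (Fin 2) k ^ 1 := by
      rw [mem_pow_idealOfVars_iff']
      intro x hx
      have hx0 : x = 0 := by rwa [Nat.lt_one_iff, Finsupp.degree_eq_zero_iff] at hx
      rw [hx0, ← constantCoeff_eq, ← eval_zero', eval_gridExpand]
      simpa using hX f hf.2
    rwa [pow_one] at this
  have h2 : pointsIdeal X ^ d ≤ (idealOfVars (Fin 2) k ^ d).comap (gridExpand w α β).toRingHom :=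
    (Ideal.pow_right_mono h1 d).trans (Ideal.le_comap_pow _ d)
  have hunit : ∀ (N : ℕ) (x : MvPolynomial (Fin 2) k),
      (gridExpand w α β).toRingHom (dualForm w 0) ^ N * x ∈ idealOfVars (Fin 2) k ^ d →
        x ∈ idealOfVars (Fin 2) k ^ d := by
    intro N x hx
    have : gridExpand w α β (dualForm w 0) = 1 := gridExpand_dualForm w α β 0
    simpa [this] using hx
  have h3 := satIdeal_le_comap _ h2 (dualForm_mem_idealOfVars w 0) hunit
  refine satIdeal_le_comap _ (sup_le h3 ?_) (dualForm_mem_idealOfVars w 0) hunit hf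
  rw [Ideal.span_singleton_le_iff_mem]
  have : gridExpand w α β Q = 0 := MvPolynomial.funext fun z => by
    rw [eval_gridExpand, hQ, map_zero]
  change gridExpand w α β Q ∈ idealOfVars (Fin 2) k ^ d
  rw [this]
  exact zero_mem _

/-- A form of degree `t` restricting to `G(x) H(y)` on the parametrized quadric. -/
noncomputable def gridLift (t : ℕ) (G H : Polynomial k) : MvPolynomial (Fin 4) k :=
  -- With truncated subtraction, x^m y^n = (xy)^min(m,n) · x^(m-n) · y^(n-m); the coordinate equal
  -- to 1 on the chart pads the degree to `t`.
  ∑ m ∈ Finset.range (t + 1), ∑ n ∈ Finset.range (t + 1), C (G.coeff m * H.coeff n) *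
    (dualForm w 0 ^ (t - max m n) * dualForm w 3 ^ min m n * dualForm w 1 ^ (m - n) *
      dualForm w 2 ^ (n - m))

lemma gridLift_isHomogeneous (t : ℕ) (G H : Polynomial k) :
    (gridLift w t G H).IsHomogeneous t := by
  refine IsHomogeneous.sum _ _ _ fun m hm => IsHomogeneous.sum _ _ _ fun n hn =>
    IsHomogeneous.C_mul ?_ _
  rw [Finset.mem_range] at hm hn
  have h := (((((dualForm_isHomogeneous w 0).pow (t - max m n)).mul
    ((dualForm_isHomogeneous w 3).pow (min m n))).mul
    ((dualForm_isHomogeneous w 1).pow (m - n))).mul ((dualForm_isHomogeneous w 2).pow (n - m)))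
  have e : 1 * (t - max m n) + 1 * min m n + 1 * (m - n) + 1 * (n - m) = t := by omega
  rwa [e] at h

lemma gridExpand_gridLift [Infinite k] {t : ℕ} {G H : Polynomial k} (hG : G.natDegree < t + 1)
    (hH : H.natDegree < t + 1) (α β : k) :
    gridExpand w α β (gridLift w t G H) =
      Polynomial.aeval (X 0 : MvPolynomial (Fin 2) k) (Polynomial.taylor α G) *
        Polynomial.aeval (X 1) (Polynomial.taylor β H) := by
  rw [Polynomial.taylor_apply, Polynomial.taylor_apply, Polynomial.aeval_comp,
    Polynomial.aeval_comp, Polynomial.aeval_eq_sum_range' hG, Polynomial.aeval_eq_sum_range' hH,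
    Finset.sum_mul_sum, gridLift, map_sum]
  refine Finset.sum_congr rfl fun m _ => ?_
  rw [map_sum]
  refine Finset.sum_congr rfl fun n _ => ?_
  simp only [map_mul, map_pow, gridExpand_dualForm]
  have hC : ∀ c : k, gridExpand w α β (C c) = C c := fun c => (gridExpand w α β).commutes c
  simp only [hC, map_add, Polynomial.aeval_X, Polynomial.aeval_C, algebraMap_eq, smul_eq_C_mul,
    Matrix.cons_val]
  rw [add_comm (X 0), add_comm (X 1)]
  generalize C α + X 0 = x
  generalize C β + X 1 = y
  rcases le_total m n with h | h
  · obtain ⟨r, rfl⟩ := Nat.exists_eq_add_of_le h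
    simp [mul_pow, pow_add]; ring
  · obtain ⟨r, rfl⟩ := Nat.exists_eq_add_of_le h
    simp [mul_pow, pow_add]; ring

lemma card_sigma_fin_sub (d : ℕ) :
    Fintype.card (Σ e : Fin d, Fin (d - e)) = (d + 1).choose 2 := by
  rw [Fintype.card_sigma]
  simp only [Fintype.card_fin]
  rw [Fin.sum_univ_eq_sum_range (fun e => d - e) d]
  induction d with
  | zero => rfl
  | succ d ih =>
    rw [Finset.sum_range_succ', Nat.choose_succ_succ, Nat.choose_one_right, ← ih]
    simp [add_comm]

lemma le_hilbertFn_sliceIdeal [Infinite k] (hα : Function.Injective α) (hβ : Function.Injective β)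
    {X : Set (P3 k)} {Q : MvPolynomial (Fin 4) k}
    (hX : ∀ f : MvPolynomial (Fin 4) k, (∀ P ∈ X, ∀ v ∈ P.submodule, eval v f = 0) →
      ∀ i j, eval (gridVec w (α i) (β j)) f = 0)
    (hQ : ∀ x y, eval (gridVec w x y) Q = 0) {d t : ℕ} (ha : a * d ≤ t + 1) (hb : b * d ≤ t + 1) :
    a * b * (d + 1).choose 2 ≤ hilbertFn (sliceIdeal Q X d) t := by
  classical
  -- One index for each grid point and each monomial of degree `e + f < d` in the two local
  -- parameters; these coefficients vanish on the `d`-th power of the maximal ideal.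
  let T := (Fin a × Fin b) × (Σ e : Fin d, Fin (d - e))
  let L : MvPolynomial (Fin 4) k →ₗ[k] T → k := LinearMap.pi fun τ =>
    (lcoeff k (Finsupp.single 0 (τ.2.1 : ℕ) + Finsupp.single 1 (τ.2.2 : ℕ))) ∘ₗ
      (gridExpand w (α τ.1.1) (β τ.1.2)).toLinearMap
  have hL : ∀ f ∈ sliceIdeal Q X d, L f = 0 := by
    intro f hf
    funext τ
    have := gridExpand_mem_of_mem_sliceIdeal w (fun f hf => hX f hf τ.1.1 τ.1.2) hQ hf
    rw [mem_pow_idealOfVars_iff'] at this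
    refine this _ ?_
    have h1 := τ.2.1.2
    have h2 := τ.2.2.2
    simp only [map_add, Finsupp.degree_single]
    omega
  refine le_trans (le_of_eq ?_) (finrank_map_le_hilbertFn _ t L hL)
  have htop : (homogeneousSubmodule (Fin 4) k t).map L = ⊤ := by
    rw [eq_top_iff, ← (Pi.basisFun k T).span_eq, Submodule.span_le]
    rintro _ ⟨⟨⟨i, j⟩, e, f⟩, rfl⟩
    have hf : (f : ℕ) < d := lt_of_lt_of_le f.2 (Nat.sub_le _ _)
    -- The product of the two interpolants has a single nonzero coefficient among those indexed by
    -- `T`, namely the one required.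
    obtain ⟨G, hGd, hG⟩ := exists_hermite hα d (Pi.single (i, e) 1)
    obtain ⟨H, hHd, hH⟩ := exists_hermite hβ d (Pi.single (j, ⟨f, hf⟩) 1)
    have hGt := natDegree_lt_succ_of_degree_lt hGd ha
    have hHt := natDegree_lt_succ_of_degree_lt hHd hb
    refine ⟨gridLift w t G H, gridLift_isHomogeneous w t G H, ?_⟩
    funext ⟨⟨i', j'⟩, e', f'⟩
    have hf' : (f' : ℕ) < d := lt_of_lt_of_le f'.2 (Nat.sub_le _ _)
    have h1 := hG i' e'
    have h2 := hH j' ⟨f', hf'⟩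
    change coeff _ (gridExpand w (α i') (β j') (gridLift w t G H)) = _
    rw [gridExpand_gridLift w hGt hHt, coeff_aeval_X_mul_aeval_X, h1]
    erw [h2]
    rw [Pi.basisFun_apply, Pi.single_apply, Pi.single_apply, Pi.single_apply]
    by_cases h : i' = i ∧ j' = j ∧ e' = e
    · obtain ⟨rfl, rfl, rfl⟩ := h
      by_cases h : f' = f
      · subst h; simp
      · have h3 : ((⟨f', hf'⟩ : Fin d)) ≠ ⟨f, hf⟩ := fun h' => h (Fin.ext (Fin.mk.inj h'))
        have h4 : ¬ (((i', j'), ⟨e', f'⟩) : T) = ((i', j'), ⟨e', f⟩) := fun h' =>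
          h (eq_of_heq (Sigma.mk.inj (Prod.mk.inj h').2).2)
        rw [if_neg h4, if_neg fun h' => h3 (Prod.mk.inj h').2, mul_zero]
    · simp only [Prod.mk.injEq]
      grind
  rw [htop, finrank_top, Module.finrank_fintype_fun_eq_card, Fintype.card_prod, Fintype.card_prod,
    card_sigma_fin_sub, Fintype.card_fin, Fintype.card_fin]

end Grid

/-! ### The squeeze in a Segre frame. -/

section GridFrame

variable {k : Type*} [Field k] (w : Module.Basis (Fin 4) k (Fin 4 → k)) {a b : ℕ}
  {α : Fin a → k} {β : Fin b → k} {Q : MvPolynomial (Fin 4) k} {c : k} {X : Set (P3 k)}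

lemma coord_zero_gridVec_sub (x y : k) : w.coord 0 (gridVec w x y - w 0) = 0 := by
  simp [repr_gridVec]

/-- The basis `w` with its first vector replaced by the point with parameters `(x, y)`. -/
noncomputable def gridBasis (x y : k) : Module.Basis (Fin 4) k (Fin 4 → k) :=
  w.map (LinearEquiv.transvection (coord_zero_gridVec_sub w x y))

lemma gridBasis_zero (x y : k) : gridBasis w x y 0 = gridVec w x y := by
  simp [gridBasis, LinearMap.transvection.apply]

lemma gridBasis_three (x y : k) : gridBasis w x y 3 = w 3 := by
  simp [gridBasis, LinearMap.transvection.apply]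

lemma eval_map_frameExpand (f : MvPolynomial (Fin 4) k) (v : Fin 4 → k) (τ : k) :
    ((frameExpand w f).map (eval v)).eval τ =
      eval (w.repr v 0 • w 0 + τ • ∑ i : Fin 3, w.repr v i.succ • w i.succ) f := by
  induction f using MvPolynomial.induction_on with
  | C r =>
    have : frameExpand w (C r) = Polynomial.C (C r) := by
      simp [algebraMap_eq]
    simp [this]
  | add p q hp hq => simp only [map_add, Polynomial.map_add, Polynomial.eval_add, hp, hq]
  | mul_X p i hp =>
    rw [map_mul, Polynomial.map_mul, Polynomial.eval_mul, hp, map_mul, eval_X]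
    congr 1
    simp [frameExpand, eval_dualForm, Fin.sum_univ_succ]
    ring

/-- On the line through the point in direction `w 3` the coordinates are (1, x, y, xy + τ), and `Q`
restricts to cτ, which has a simple zero. -/
lemma not_X_sq_dvd_frameExpand_gridBasis [Infinite k] (hc : c ≠ 0)
    (hQ : ∀ x : Fin 4 → k, eval (∑ i, x i • w i) Q = c * (x 0 * x 3 - x 1 * x 2)) (x y : k) :
    ¬ Polynomial.X ^ 2 ∣ frameExpand (gridBasis w x y) Q := by
  intro h
  set w' := gridBasis w x y
  have h1 : (frameExpand w' Q).map (eval (w' 0 + w' 3)) = Polynomial.C c * Polynomial.X := by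
    refine Polynomial.funext fun τ => ?_
    rw [eval_map_frameExpand]
    have hv : w'.repr (w' 0 + w' 3) 0 • w' 0 +
        τ • ∑ i : Fin 3, w'.repr (w' 0 + w' 3) i.succ • w' i.succ =
        ∑ i, (![1, x, y, x * y + τ] : Fin 4 → k) i • w i := by
      have h0 : w' 0 = gridVec w x y := gridBasis_zero w x y
      have h3 : w' 3 = w 3 := gridBasis_three w x y
      simp [Fin.sum_univ_succ, Finsupp.single_apply]
      simp [h0, h3, gridVec, add_smul]
      abel
    rw [hv, hQ]
    simp
  have h2 := Polynomial.map_dvd (eval (w' 0 + w' 3)) h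
  rw [h1, Polynomial.map_pow, Polynomial.map_X, Polynomial.X_pow_dvd_iff] at h2
  exact hc (by simpa using h2 1 one_lt_two)

/-- A form vanishing at every point of the grid except at the one with index `ij`. -/
noncomputable def gridSeparator (α : Fin a → k) (β : Fin b → k) (ij : Fin a × Fin b) :
    MvPolynomial (Fin 4) k :=
  (∏ i ∈ Finset.univ.erase ij.1, (dualForm w 1 - C (α i) * dualForm w 0)) *
    ∏ j ∈ Finset.univ.erase ij.2, (dualForm w 2 - C (β j) * dualForm w 0)

lemma gridSeparator_isHomogeneous (ij : Fin a × Fin b) :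
    (gridSeparator w α β ij).IsHomogeneous ((a - 1) + (b - 1)) := by
  have h : ∀ (i : Fin 4) (r : k), (dualForm w i - C r * dualForm w 0).IsHomogeneous 1 := fun i r =>
    (dualForm_isHomogeneous w i).sub ((dualForm_isHomogeneous w 0).C_mul r)
  refine IsHomogeneous.mul ?_ ?_
  · simpa using IsHomogeneous.prod (Finset.univ.erase ij.1)
      (fun i => dualForm w 1 - C (α i) * dualForm w 0) (fun _ => 1) fun i _ => h 1 (α i)
  · simpa using IsHomogeneous.prod (Finset.univ.erase ij.2)
      (fun j => dualForm w 2 - C (β j) * dualForm w 0) (fun _ => 1) fun j _ => h 2 (β j)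

lemma eval_gridSeparator (ij : Fin a × Fin b) (x y : k) :
    eval (gridVec w x y) (gridSeparator w α β ij) =
      (∏ i ∈ Finset.univ.erase ij.1, (x - α i)) * ∏ j ∈ Finset.univ.erase ij.2, (y - β j) := by
  simp [gridSeparator, eval_dualForm, repr_gridVec]

/-- All degrees from bd-1 on are treated together: the induction lowers `t` by 2, and the
multiplicity needs every large `t`. The case `d = 0` serves as base for the fat points. -/
theorem hilbertFn_of_gridFrame [Infinite k] (hQ2 : Q.IsHomogeneous 2) (hc : c ≠ 0)
    (hQ : ∀ x : Fin 4 → k, eval (∑ i, x i • w i) Q = c * (x 0 * x 3 - x 1 * x 2))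
    (hα : Function.Injective α) (hβ : Function.Injective β)
    (hX : ∀ f : MvPolynomial (Fin 4) k, (∀ P ∈ X, ∀ v ∈ P.submodule, eval v f = 0) ↔
      ∀ i j, ∀ r : k, eval (r • gridVec w (α i) (β j)) f = 0)
    (hb : 2 ≤ b) (hab : a ≤ b) (d t : ℕ) (ht : b * d ≤ t + 1) :
    hilbertFn (fatIdeal X d) t = a * b * (d + 2).choose 3 ∧
      (0 < d → hilbertFn (sliceIdeal Q X d) t = a * b * (d + 1).choose 2) := by
  let W : Fin a × Fin b → Module.Basis (Fin 4) k (Fin 4 → k) := fun ij =>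
    gridBasis w (α ij.1) (β ij.2)
  have hW : ∀ ij, W ij 0 = gridVec w (α ij.1) (β ij.2) := fun ij => gridBasis_zero _ _ _
  have hXW : IsPointSet W X := fun f => by
    rw [hX f]
    simp only [hW, Prod.forall]
  have hs : ∀ ij, (gridSeparator w α β ij).IsHomogeneous ((a - 1) + (b - 1)) :=
    gridSeparator_isHomogeneous w
  have hsi : ∀ ij, eval (W ij 0) (gridSeparator w α β ij) ≠ 0 := fun ij => by
    rw [hW, eval_gridSeparator]
    refine mul_ne_zero (Finset.prod_ne_zero_iff.2 fun i hi => ?_)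
      (Finset.prod_ne_zero_iff.2 fun j hj => ?_)
    · exact sub_ne_zero.2 (hα.ne (Finset.ne_of_mem_erase hi).symm)
    · exact sub_ne_zero.2 (hβ.ne (Finset.ne_of_mem_erase hj).symm)
  have hsj : ∀ ij ij', ij ≠ ij' → eval (W ij' 0) (gridSeparator w α β ij) = 0 := by
    intro ij ij' hne
    rw [hW, eval_gridSeparator]
    by_cases h : ij.1 = ij'.1
    · have h2 : ij.2 ≠ ij'.2 := fun h2 => hne (Prod.ext h h2)
      rw [Finset.prod_eq_zero (Finset.mem_erase.2 ⟨h2.symm, Finset.mem_univ _⟩) (sub_self (β ij'.2)),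
        mul_zero]
    · rw [Finset.prod_eq_zero (Finset.mem_erase.2 ⟨Ne.symm h, Finset.mem_univ _⟩)
        (sub_self (α ij'.1)), zero_mul]
  have hdvd : ∀ ij, ¬ Polynomial.X ^ 2 ∣ frameExpand (W ij) Q := fun ij =>
    not_X_sq_dvd_frameExpand_gridBasis w hc hQ _ _
  have hQ0 : Q ≠ 0 := by
    rintro rfl
    have := hQ ![1, 0, 0, 1]
    simp [hc.symm] at this
  have hup : ∀ d t, hilbertFn (fatIdeal X d) t ≤ a * b * (d + 2).choose 3 := fun d t => by
    simpa using hilbertFn_fatIdeal_le hXW hs hsi hsj d t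
  have hlow : ∀ {d t}, b * d ≤ t + 1 →
      a * b * (d + 1).choose 2 ≤ hilbertFn (sliceIdeal Q X d) t := fun {d t} h => by
    refine le_hilbertFn_sliceIdeal w hα hβ (fun f hf i j => ?_) (fun x y => ?_)
      ((Nat.mul_le_mul_right d hab).trans h) h
    · simpa using (hX f).1 hf i j 1
    · have := hQ ![1, x, y, x * y]
      simpa [Fin.sum_univ_succ, gridVec, add_assoc] using this
  induction d generalizing t with
  | zero => exact ⟨le_antisymm (hup 0 t) (by simp [Nat.choose]), fun h => absurd h (lt_irrefl 0)⟩
  | succ d ih =>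
    have hpas : (d + 1 + 2).choose 3 = (d + 1 + 1).choose 2 + (d + 2).choose 3 :=
      Nat.choose_succ_succ (d + 2) 2
    have h1 := hup (d + 1) t
    have h2 := hlow ht
    have h3 : a * b * (d + 2).choose 3 + hilbertFn (sliceIdeal Q X (d + 1)) t ≤
        hilbertFn (fatIdeal X (d + 1)) t := by
      rcases Nat.eq_zero_or_pos d with rfl | hd
      -- Here `t` may be 1, leaving no room for a shift by 2. The first summand is zero, so the
      -- inclusion of ideals suffices.
      · simpa [Nat.choose, sliceIdeal] using hilbertFn_antitone (le_sup_left.trans (le_satIdeal _)) t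
      · have hbd : b * 1 ≤ b * d := Nat.mul_le_mul_left b hd
        rw [mul_add] at ht
        -- Since b ≥ 2, the bound b(d+1) ≤ t+1 gives bd ≤ (t-2)+1, as the induction hypothesis
        -- requires.
        obtain ⟨t, rfl⟩ : ∃ s, t = s + 2 := ⟨t - 2, by omega⟩
        rw [← (ih t (by omega)).1]
        exact hilbertFn_fatIdeal_succ_ge hXW hs hsi hsj hQ2 hQ0 hdvd d t
    rw [hpas, mul_add] at h1 ⊢
    exact ⟨by omega, fun _ => by omega⟩

end GridFrame

/-! ### Segre coordinates from lines on a smooth quadric. -/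

/-- The quadric `Q = 0` is parametrized by the Segre map in the coordinates given by `w`. -/
def IsSegreFrame {k : Type*} [Field k] (Q : MvPolynomial (Fin 4) k) (w : Fin 4 → Fin 4 → k)
    (c : k) : Prop :=
  ∀ x : Fin 4 → k, eval (∑ i, x i • w i) Q = c * (x 0 * x 3 - x 1 * x 2)

section Geometry

variable {k : Type*} [Field k] {Q : MvPolynomial (Fin 4) k} {w : Fin 4 → Fin 4 → k} {c : k}

/-- The symmetric bilinear form of a quadratic form, and its relation to the partial derivatives. -/
lemma exists_bilin_of_isHomogeneous_two [CharZero k] {σ : Type*} [Fintype σ]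
    {Q : MvPolynomial σ k} (hQ : Q.IsHomogeneous 2) :
    ∃ B : (σ → k) →ₗ[k] (σ → k) →ₗ[k] k, (∀ u v, B u v = B v u) ∧ (∀ v, eval v Q = B v v) ∧
      ∀ u v, ∑ i, u i * eval v (pderiv i Q) = 2 * B u v := by
  classical
  have h : Q ∈ homogeneousSubmodule σ k 2 := hQ
  rw [← homogeneousSubmodule_one_pow, homogeneousSubmodule_one_eq_span_X, pow_two,
    Submodule.span_mul_span] at h
  clear hQ
  induction h using Submodule.span_induction with
  | mem f hf =>
    obtain ⟨_, ⟨i, rfl⟩, _, ⟨j, rfl⟩, rfl⟩ := hf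
    let P : σ → (σ → k) →ₗ[k] k := fun i => LinearMap.proj i
    refine ⟨(2⁻¹ : k) • ((P i).smulRight (P j) + (P j).smulRight (P i)), fun u v => ?_, fun v => ?_,
      fun u v => ?_⟩
    · simp [P]; ring
    · simp [P]; ring
    · simp only [pderiv_mul, pderiv_X, map_add, map_mul, eval_X, mul_add, Finset.sum_add_distrib]
      simp [P, Pi.single_apply, Finset.sum_ite_eq, apply_ite]
      ring
  | zero => exact ⟨0, by simp, by simp, by simp⟩
  | add f g _ _ hf hg =>
    obtain ⟨B, h1, h2, h3⟩ := hf
    obtain ⟨B', h1', h2', h3'⟩ := hg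
    exact ⟨B + B', fun u v => by simp [h1 u v, h1' u v], fun v => by simp [h2, h2'],
      fun u v => by simp [mul_add, Finset.sum_add_distrib, h3, h3']⟩
  | smul r f _ hf =>
    obtain ⟨B, h1, h2, h3⟩ := hf
    refine ⟨r • B, fun u v => by simp [h1 u v], fun v => by simp [h2], fun u v => ?_⟩
    have := congrArg (r * ·) (h3 u v)
    simp only [Finset.mul_sum] at this
    simp only [smul_eval, LinearMap.smul_apply, smul_eq_mul, Derivation.map_smul]
    rw [mul_left_comm 2 r, ← this]
    exact Finset.sum_congr rfl fun i _ => by ring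

/-- A linear relation `x` would leave the form y₀y₃ - y₁y₂ invariant under translation by `x`; this
form is nondegenerate, so `x = 0`. -/
lemma IsSegreFrame.linearIndependent (hw : IsSegreFrame Q w c) (hc : c ≠ 0) :
    LinearIndependent k w := by
  rw [Fintype.linearIndependent_iff]
  intro x hx
  have key : ∀ y : Fin 4 → k, (x 0 + y 0) * (x 3 + y 3) - (x 1 + y 1) * (x 2 + y 2) =
      y 0 * y 3 - y 1 * y 2 := fun y => by
    have h1 := hw (x + y)
    have h2 := hw y
    simp only [Pi.add_apply, add_smul, Finset.sum_add_distrib, hx, zero_add] at h1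
    exact (mul_left_cancel₀ hc (h2.symm.trans h1)).symm
  have h0 := key 0
  have h : ∀ i, x i = 0 := by
    have e0 := key (Pi.single 0 1)
    have e1 := key (Pi.single 1 1)
    have e2 := key (Pi.single 2 1)
    have e3 := key (Pi.single 3 1)
    simp at h0 e0 e1 e2 e3
    intro i
    fin_cases i
    · show x 0 = 0
      linear_combination e3 - h0
    · show x 1 = 0
      linear_combination h0 - e2
    · show x 2 = 0
      linear_combination h0 - e1
    · show x 3 = 0
      linear_combination e0 - h0
  exact h

lemma IsSegreFrame.swap (hw : IsSegreFrame Q w c) :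
    IsSegreFrame Q ![w 0, w 2, w 1, w 3] c := fun x => by
  have := hw ![x 0, x 2, x 1, x 3]
  simp [Fin.sum_univ_succ] at this ⊢
  rw [add_left_comm (x 2 • w 1), mul_comm (x 2)] at this
  exact this

/-- This moves the points at infinity of the two parameter lines: a line with homogeneous parameter
(s : s') gets the affine parameter s'/(s + ps'), and similarly with `q` for the other ruling. -/
lemma IsSegreFrame.translate (hw : IsSegreFrame Q w c) (p q : k) :
    IsSegreFrame Q ![w 0, w 1 - p • w 0, w 2 - q • w 0,
      w 3 - p • w 2 - q • w 1 + (p * q) • w 0] c := fun x => by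
  have := hw ![x 0 - p * x 1 - q * x 2 + p * q * x 3, x 1 - q * x 3, x 2 - p * x 3, x 3]
  have e : ∑ i, x i • ![w 0, w 1 - p • w 0, w 2 - q • w 0,
      w 3 - p • w 2 - q • w 1 + (p * q) • w 0] i =
      ∑ i, ![x 0 - p * x 1 - q * x 2 + p * q * x 3, x 1 - q * x 3, x 2 - p * x 3, x 3] i • w i := by
    simp [Fin.sum_univ_four]
    module
  rw [e, this]
  simp
  ring_nf
  simp

lemma exists_eq_of_mem_isLineOn {M : Submodule k (Fin 4 → k)} (hM : IsLineOn Q M)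
    {e f u : Fin 4 → k} (he : e ∈ M) (hf : f ∈ M) (hef : LinearIndependent k ![e, f])
    (hu : u ∈ M) : ∃ s s' : k, u = s • e + s' • f := by
  have hle : Submodule.span k {e, f} ≤ M := Submodule.span_le.2 (by
    rintro _ (rfl | rfl) <;> assumption)
  have h2 : Module.finrank k (Submodule.span k {e, f}) = 2 := by
    have := finrank_span_eq_card hef
    rwa [Matrix.range_cons_cons_empty, Fintype.card_fin] at this
  have := Submodule.eq_of_le_of_finrank_eq hle (h2.trans hM.1.symm)
  rw [← this, Submodule.mem_span_pair] at hu
  obtain ⟨s, s', h⟩ := hu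
  exact ⟨s, s', h.symm⟩

/-- A line on the quadric meeting two skew lines is given by one pair of parameters. -/
lemma IsSegreFrame.exists_params (hw : IsSegreFrame Q w c) (hc : c ≠ 0)
    {M₀ M₁ L : Submodule k (Fin 4 → k)} (hM₀ : IsLineOn Q M₀) (hM₁ : IsLineOn Q M₁)
    (hL : IsLineOn Q L) (h0 : w 0 ∈ M₀) (h1 : w 1 ∈ M₀) (h2 : w 2 ∈ M₁) (h3 : w 3 ∈ M₁)
    (hL0 : L ⊓ M₀ ≠ ⊥) (hL1 : L ⊓ M₁ ≠ ⊥) :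
    ∃ s s' : k, (s ≠ 0 ∨ s' ≠ 0) ∧ s • w 0 + s' • w 1 ∈ L ∧ s • w 2 + s' • w 3 ∈ L := by
  have hind := hw.linearIndependent hc
  obtain ⟨u, ⟨huL, huM⟩, hu0⟩ := Submodule.exists_mem_ne_zero_of_ne_bot hL0
  obtain ⟨v, ⟨hvL, hvM⟩, hv0⟩ := Submodule.exists_mem_ne_zero_of_ne_bot hL1
  have i01 : LinearIndependent k ![w 0, w 1] := by
    have := hind.comp ![0, 1] (by decide)
    convert this using 1
    ext i; fin_cases i <;> rfl
  have i23 : LinearIndependent k ![w 2, w 3] := by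
    have := hind.comp ![2, 3] (by decide)
    convert this using 1
    ext i; fin_cases i <;> rfl
  obtain ⟨s, s', rfl⟩ := exists_eq_of_mem_isLineOn hM₀ h0 h1 i01 huM
  obtain ⟨r, r', rfl⟩ := exists_eq_of_mem_isLineOn hM₁ h2 h3 i23 hvM
  -- The sum of the two intersection points lies on `L`. The value of `Q` there is c(sr' - s'r), so
  -- both points have the same ratio of parameters.
  have hq := hL.2 _ (L.add_mem huL hvL)
  have := hw ![s, s', r, r']
  simp only [Fin.sum_univ_four, Matrix.cons_val] at this
  rw [add_assoc (s • w 0 + s' • w 1), hq] at this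
  have hdet : s * r' = s' * r := sub_eq_zero.1 ((mul_eq_zero.1 this.symm).resolve_left hc)
  have hs : s ≠ 0 ∨ s' ≠ 0 := by
    by_contra! h
    simp [h.1, h.2] at hu0
  refine ⟨s, s', hs, huL, ?_⟩
  rcases hs with hs | hs
  · have hr : r ≠ 0 := by
      rintro rfl
      have : r' = 0 := by simpa [hs] using hdet
      simp [this] at hv0
    have : s • w 2 + s' • w 3 = (s / r) • (r • w 2 + r' • w 3) := by
      rw [smul_add, smul_smul, smul_smul, div_mul_cancel₀ _ hr, div_mul_eq_mul_div, hdet,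
        mul_div_cancel_right₀ _ hr]
    rw [this]
    exact L.smul_mem _ hvL
  · have hr : r' ≠ 0 := by
      rintro rfl
      have : r = 0 := by simpa [hs] using hdet.symm
      simp [this] at hv0
    have : s • w 2 + s' • w 3 = (s' / r') • (r • w 2 + r' • w 3) := by
      rw [smul_add, smul_smul, smul_smul, div_mul_cancel₀ _ hr, div_mul_eq_mul_div, ← hdet,
        mul_div_cancel_right₀ _ hr]
    rw [this]
    exact L.smul_mem _ hvL

lemma exists_isSegreFrame [CharZero k] (hQ : IsSmoothQuadric Q)
    {l₀ l₁ m₀ m₁ : Submodule k (Fin 4 → k)} (hl₀ : IsLineOn Q l₀) (hl₁ : IsLineOn Q l₁)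
    (hm₀ : IsLineOn Q m₀) (hm₁ : IsLineOn Q m₁) (hl : l₀ ⊓ l₁ = ⊥) (hm : m₀ ⊓ m₁ = ⊥)
    (h00 : l₀ ⊓ m₀ ≠ ⊥) (h01 : l₀ ⊓ m₁ ≠ ⊥) (h10 : l₁ ⊓ m₀ ≠ ⊥) (h11 : l₁ ⊓ m₁ ≠ ⊥) :
    ∃ (w : Fin 4 → Fin 4 → k) (c : k), c ≠ 0 ∧ IsSegreFrame Q w c ∧ w 0 ∈ l₀ ⊓ m₀ ∧
      w 1 ∈ l₁ ⊓ m₀ ∧ w 2 ∈ l₀ ⊓ m₁ ∧ w 3 ∈ l₁ ⊓ m₁ := by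
  obtain ⟨B, hsymm, hBQ, hBd⟩ := exists_bilin_of_isHomogeneous_two hQ.1
  have hnd : ∀ v, v ≠ 0 → ∃ u, B u v ≠ 0 := by
    intro v hv
    by_contra! h
    obtain ⟨i, hi⟩ := hQ.2 v hv (by rw [hBQ, h])
    refine hi ?_
    have := hBd (Pi.single i 1) v
    simpa [h, Pi.single_apply] using this
  have hiso : ∀ L, IsLineOn Q L → ∀ u ∈ L, ∀ v ∈ L, B u v = 0 := by
    intro L hL u hu v hv
    have h1 := hL.2 _ (L.add_mem hu hv)
    have h2 := hL.2 _ hu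
    have h3 := hL.2 _ hv
    rw [hBQ] at h1 h2 h3
    simp only [map_add, LinearMap.add_apply, h2, h3, hsymm v u] at h1
    have : (2 : k) * B u v = 0 := by linear_combination h1
    simpa using this
  obtain ⟨e0, ⟨hl0, hm0⟩, he0⟩ := Submodule.exists_mem_ne_zero_of_ne_bot h00
  obtain ⟨e1, ⟨hl1, hm1⟩, he1⟩ := Submodule.exists_mem_ne_zero_of_ne_bot h10
  obtain ⟨e2, ⟨hl2, hm2⟩, he2⟩ := Submodule.exists_mem_ne_zero_of_ne_bot h01
  obtain ⟨e3, ⟨hl3, hm3⟩, he3⟩ := Submodule.exists_mem_ne_zero_of_ne_bot h11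
  have hbot : ∀ {L M : Submodule k (Fin 4 → k)}, L ⊓ M = ⊥ → ∀ u ∈ L, ∀ v ∈ M, u + v = 0 →
      u = 0 ∧ v = 0 := by
    intro L M hLM u hu v hv huv
    have : u ∈ L ⊓ M := ⟨hu, by rw [eq_neg_of_add_eq_zero_left huv]; exact M.neg_mem hv⟩
    rw [hLM, Submodule.mem_bot] at this
    exact ⟨this, by simpa [this] using huv⟩
  have hind : LinearIndependent k ![e0, e1, e2, e3] := by
    rw [Fintype.linearIndependent_iff]
    intro x hx
    simp only [Fin.sum_univ_four, Matrix.cons_val] at hx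
    obtain ⟨hA, hB⟩ := hbot hl (x 0 • e0 + x 2 • e2)
      (l₀.add_mem (l₀.smul_mem _ hl0) (l₀.smul_mem _ hl2)) (x 1 • e1 + x 3 • e3)
      (l₁.add_mem (l₁.smul_mem _ hl1) (l₁.smul_mem _ hl3)) (by rw [← hx]; abel)
    obtain ⟨hx0, hx2⟩ := hbot hm _ (m₀.smul_mem _ hm0) _ (m₁.smul_mem _ hm2) hA
    obtain ⟨hx1, hx3⟩ := hbot hm _ (m₀.smul_mem _ hm1) _ (m₁.smul_mem _ hm3) hB
    intro i
    fin_cases i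
    · exact (smul_eq_zero.1 hx0).resolve_right he0
    · exact (smul_eq_zero.1 hx1).resolve_right he1
    · exact (smul_eq_zero.1 hx2).resolve_right he2
    · exact (smul_eq_zero.1 hx3).resolve_right he3
  have hspan : ∀ u, ∃ x : Fin 4 → k, u = x 0 • e0 + x 1 • e1 + x 2 • e2 + x 3 • e3 := by
    intro u
    let bas := basisOfLinearIndependentOfCardEqFinrank hind (by simp)
    refine ⟨bas.repr u, ?_⟩
    have := (bas.sum_repr u).symm
    simpa [bas, Fin.sum_univ_four] using this
  have b01 := hiso _ hm₀ _ hm0 _ hm1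
  have b02 := hiso _ hl₀ _ hl0 _ hl2
  have b13 := hiso _ hl₁ _ hl1 _ hl3
  have b23 := hiso _ hm₁ _ hm2 _ hm3
  have b00 := hiso _ hm₀ _ hm0 _ hm0
  have b11 := hiso _ hm₀ _ hm1 _ hm1
  have b22 := hiso _ hm₁ _ hm2 _ hm2
  have b33 := hiso _ hm₁ _ hm3 _ hm3
  have b10 := (hsymm e1 e0).trans b01
  have b20 := (hsymm e2 e0).trans b02
  have b31 := (hsymm e3 e1).trans b13
  have b32 := (hsymm e3 e2).trans b23
  -- Lines on the quadric are isotropic, so only the pairings of `e0` with `e3` and of `e1` with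
  -- `e2` can be nonzero; nondegeneracy forces both to be.
  have hp : B e3 e0 ≠ 0 := by
    intro h
    obtain ⟨u, hu⟩ := hnd e0 he0
    obtain ⟨x, rfl⟩ := hspan u
    exact hu (by simp [b00, b10, b20, h])
  have hq : B e2 e1 ≠ 0 := by
    intro h
    obtain ⟨u, hu⟩ := hnd e1 he1
    obtain ⟨x, rfl⟩ := hspan u
    exact hu (by simp [b11, b01, b31, h])
  -- Rescaling `e3` makes the two surviving pairings opposite; each occurs twice in B(v, v), whence
  -- the factor 2 in the constant.
  refine ⟨![e0, e1, e2, (-(B e2 e1 / B e3 e0)) • e3], -2 * B e2 e1, by simpa using hq, fun x => ?_,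
    ⟨hl0, hm0⟩, ⟨hl1, hm1⟩, ⟨hl2, hm2⟩, ⟨l₁.smul_mem _ hl3, m₁.smul_mem _ hm3⟩⟩
  rw [hBQ]
  have h03 := hsymm e0 e3
  have h12 := hsymm e1 e2
  simp only [Fin.sum_univ_four, Matrix.cons_val, map_add, map_smul, LinearMap.add_apply,
    LinearMap.smul_apply, smul_eq_mul, b00, b01, b02, b10, b11, b13, b20, b22, b23, b31, b32, b33,
    h03, h12]
  field_simp
  ring

end Geometry

/-! ### Rulings, and affine parameters for a grid. -/

section Ruling

variable {k : Type*} [Field k] {Q : MvPolynomial (Fin 4) k}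
  {𝓡 𝓢 : Set (Submodule k (Fin 4 → k))} {L M : Submodule k (Fin 4 → k)}

lemma IsRuling.inf_eq_bot (h : IsRuling Q 𝓡) (hL : L ∈ 𝓡) (hM : M ∈ 𝓡) (hne : L ≠ M) :
    L ⊓ M = ⊥ :=
  ((h.2.2 M hM L (h.2.1 L hL)).1 hL).resolve_left hne

lemma IsRuling.eq_of_mem (h : IsRuling Q 𝓡) (h' : IsRuling Q 𝓢) (hL : L ∈ 𝓡) (hL' : L ∈ 𝓢) :
    𝓡 = 𝓢 := by
  ext N
  constructor
  · intro hN
    exact (h'.2.2 L hL' N (h.2.1 N hN)).2 ((h.2.2 L hL N (h.2.1 N hN)).1 hN)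
  · intro hN
    exact (h.2.2 L hL N (h'.2.1 N hN)).2 ((h'.2.2 L hL' N (h'.2.1 N hN)).1 hN)

/-- A line disjoint from a member of a ruling belongs to that ruling, and a ruling is determined by
any one of its lines. -/
lemma IsRuling.inf_ne_bot (h : IsRuling Q 𝓡) (h' : IsRuling Q 𝓢) (hne : 𝓡 ≠ 𝓢) (hL : L ∈ 𝓡)
    (hM : M ∈ 𝓢) : L ⊓ M ≠ ⊥ := fun hbot =>
  hne (h.eq_of_mem h' ((h.2.2 L hL M (h'.2.1 M hM)).2 (Or.inr (by rwa [inf_comm]))) hM)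

lemma IsRuling.finrank_inf (h : IsRuling Q 𝓡) (h' : IsRuling Q 𝓢) (hne : 𝓡 ≠ 𝓢) (hL : L ∈ 𝓡)
    (hM : M ∈ 𝓢) : Module.finrank k (L ⊓ M : Submodule k (Fin 4 → k)) = 1 := by
  have h0 : Module.finrank k (L ⊓ M : Submodule k (Fin 4 → k)) ≠ 0 := fun h0 =>
    h.inf_ne_bot h' hne hL hM (Submodule.finrank_eq_zero.1 h0)
  have h2 : Module.finrank k (L ⊓ M : Submodule k (Fin 4 → k)) ≤ 2 :=
    (Submodule.finrank_mono inf_le_left).trans (h.2.1 L hL).1.le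
  have h1 : Module.finrank k (L ⊓ M : Submodule k (Fin 4 → k)) ≠ 2 := by
    intro h2
    have e1 := Submodule.eq_of_le_of_finrank_eq (inf_le_left : L ⊓ M ≤ L)
      (h2.trans (h.2.1 L hL).1.symm)
    have e2 := Submodule.eq_of_le_of_finrank_eq (inf_le_right : L ⊓ M ≤ M)
      (h2.trans (h'.2.1 M hM).1.symm)
    exact hne (h.eq_of_mem h' hL (by rwa [← e1, e2]))
  omega

lemma exists_forall_add_mul_ne_zero [Infinite k] {ι : Type*} [Finite ι] (s s' : ι → k)
    (h : ∀ i, s i ≠ 0 ∨ s' i ≠ 0) : ∃ p, ∀ i, s i + p * s' i ≠ 0 := by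
  classical
  have := Fintype.ofFinite ι
  obtain ⟨p, hp⟩ := Infinite.exists_notMem_finset (Finset.univ.image fun i => -s i / s' i)
  refine ⟨p, fun i hi => ?_⟩
  by_cases hs : s' i = 0
  · rw [hs, mul_zero, add_zero] at hi
    exact (h i).elim (fun h => h hi) fun h => h hs
  · refine hp (Finset.mem_image.2 ⟨i, Finset.mem_univ _, ?_⟩)
    rw [div_eq_iff hs]
    linear_combination -hi

/-- In a suitable frame, the lines of the two rulings through a grid are given by affine
parameters. -/
lemma IsGrid.exists_frame [CharZero k] (hQ : IsSmoothQuadric Q) {a b : ℕ} (ha : 2 ≤ a) (hb : 2 ≤ b)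
    {X : Set (P3 k)} (hX : IsGrid Q a b X) :
    ∃ (w : Module.Basis (Fin 4) k (Fin 4 → k)) (c : k) (α : Fin a → k) (β : Fin b → k),
      c ≠ 0 ∧ IsSegreFrame Q w c ∧ Function.Injective α ∧ Function.Injective β ∧
      ∀ f : MvPolynomial (Fin 4) k, (∀ P ∈ X, ∀ v ∈ P.submodule, eval v f = 0) ↔
        ∀ i j, ∀ r : k, eval (r • gridVec w (α i) (β j)) f = 0 := by
  obtain ⟨𝓡, 𝓢, hR, hS, hne, l, m, hlinj, hminj, hl, hm, rfl⟩ := hX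
  have hlne : l ⟨0, by omega⟩ ≠ l ⟨1, by omega⟩ := hlinj.ne (by simp)
  have hmne : m ⟨0, by omega⟩ ≠ m ⟨1, by omega⟩ := hminj.ne (by simp)
  have hlm : ∀ i j, l i ⊓ m j ≠ ⊥ := fun i j => hR.inf_ne_bot hS hne (hl i) (hm j)
  have hll : ∀ i, IsLineOn Q (l i) := fun i => hR.2.1 _ (hl i)
  have hml : ∀ j, IsLineOn Q (m j) := fun j => hS.2.1 _ (hm j)
  obtain ⟨w, c, hc, hw, ⟨h0l, h0m⟩, ⟨h1l, h1m⟩, ⟨h2l, h2m⟩, ⟨h3l, h3m⟩⟩ :=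
    exists_isSegreFrame hQ (hll _) (hll _) (hml _) (hml _) (hR.inf_eq_bot (hl _) (hl _) hlne)
      (hS.inf_eq_bot (hm _) (hm _) hmne) (hlm _ _) (hlm _ _) (hlm _ _) (hlm _ _)
  choose s s' hs hs1 hs2 using fun i => hw.exists_params hc (hml _) (hml _) (hll i) h0m h1m h2m h3m
    (hlm _ _) (hlm _ _)
  choose u u' hu hu1 hu2 using fun j => hw.swap.exists_params hc (hll _) (hll _) (hml j) h0l h2l
    h1l h3l (by rw [inf_comm]; exact hlm _ _) (by rw [inf_comm]; exact hlm _ _)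
  simp only [Matrix.cons_val] at hu1 hu2
  -- Only finitely many values of `p` and `q` would put a line at infinity, and the field is
  -- infinite.
  obtain ⟨p, hp⟩ := exists_forall_add_mul_ne_zero s s' hs
  obtain ⟨q, hq⟩ := exists_forall_add_mul_ne_zero u u' hu
  have hw' := hw.translate p q
  set W : Fin 4 → Fin 4 → k := ![w 0, w 1 - p • w 0, w 2 - q • w 0,
    w 3 - p • w 2 - q • w 1 + (p * q) • w 0] with hW
  let bas := basisOfLinearIndependentOfCardEqFinrank (hw'.linearIndependent hc) (by simp)
  have hbas : (bas : Fin 4 → Fin 4 → k) = W := coe_basisOfLinearIndependentOfCardEqFinrank _ _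
  let α : Fin a → k := fun i => s' i / (s i + p * s' i)
  let β : Fin b → k := fun j => u' j / (u j + q * u' j)
  have hl1 : ∀ i, W 0 + α i • W 1 ∈ l i := fun i => by
    have e : W 0 + α i • W 1 = (s i + p * s' i)⁻¹ • (s i • w 0 + s' i • w 1) := by
      rw [eq_inv_smul_iff₀ (hp i), smul_add, smul_smul, mul_div_cancel₀ _ (hp i)]
      simp only [hW, Matrix.cons_val]
      module
    rw [e]
    exact (l i).smul_mem _ (hs1 i)
  have hl2 : ∀ i, W 2 + α i • W 3 ∈ l i := fun i => by
    have e : W 2 + α i • W 3 = (s i + p * s' i)⁻¹ •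
        ((s i • w 2 + s' i • w 3) - q • (s i • w 0 + s' i • w 1)) := by
      rw [eq_inv_smul_iff₀ (hp i), smul_add, smul_smul, mul_div_cancel₀ _ (hp i)]
      simp only [hW, Matrix.cons_val]
      module
    rw [e]
    exact (l i).smul_mem _ ((l i).sub_mem (hs2 i) ((l i).smul_mem _ (hs1 i)))
  have hm1 : ∀ j, W 0 + β j • W 2 ∈ m j := fun j => by
    have e : W 0 + β j • W 2 = (u j + q * u' j)⁻¹ • (u j • w 0 + u' j • w 2) := by
      rw [eq_inv_smul_iff₀ (hq j), smul_add, smul_smul, mul_div_cancel₀ _ (hq j)]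
      simp only [hW, Matrix.cons_val]
      module
    rw [e]
    exact (m j).smul_mem _ (hu1 j)
  have hm2 : ∀ j, W 1 + β j • W 3 ∈ m j := fun j => by
    have e : W 1 + β j • W 3 = (u j + q * u' j)⁻¹ •
        ((u j • w 1 + u' j • w 3) - p • (u j • w 0 + u' j • w 2)) := by
      rw [eq_inv_smul_iff₀ (hq j), smul_add, smul_smul, mul_div_cancel₀ _ (hq j)]
      simp only [hW, Matrix.cons_val]
      module
    rw [e]
    exact (m j).smul_mem _ ((m j).sub_mem (hu2 j) ((m j).smul_mem _ (hu1 j)))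
  have hrepr : ∀ x y : k, gridVec W x y ≠ 0 := fun x y h0 => by
    have := repr_gridVec bas x y 0
    rw [hbas, h0] at this
    simp at this
  have hspan : ∀ i j, l i ⊓ m j = Submodule.span k {gridVec W (α i) (β j)} := fun i j => by
    refine (Submodule.eq_of_le_of_finrank_eq ?_ ?_).symm
    · rw [Submodule.span_singleton_le_iff_mem]
      constructor
      · have := (l i).add_mem (hl1 i) ((l i).smul_mem (β j) (hl2 i))
        have e : gridVec W (α i) (β j) = W 0 + α i • W 1 + β j • (W 2 + α i • W 3) := by
          simp only [gridVec]
          module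
        rwa [← e] at this
      · have := (m j).add_mem (hm1 j) ((m j).smul_mem (α i) (hm2 j))
        have e : gridVec W (α i) (β j) = W 0 + β j • W 2 + α i • (W 1 + β j • W 3) := by
          simp only [gridVec]
          module
        rwa [← e] at this
    · rw [finrank_span_singleton (hrepr _ _), hR.finrank_inf hS hne (hl i) (hm j)]
  refine ⟨bas, c, α, β, hc, hbas ▸ hw', fun i i' h => ?_, fun j j' h => ?_, fun f => ?_⟩
  · by_contra hii
    have := hR.inf_eq_bot (hl i) (hl i') (hlinj.ne hii)
    refine hrepr (α i) 0 ?_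
    have h1 : gridVec W (α i) 0 = W 0 + α i • W 1 := by simp [gridVec]
    rw [← Submodule.mem_bot k, ← this, h1]
    exact ⟨hl1 i, h ▸ hl1 i'⟩
  · by_contra hjj
    have := hS.inf_eq_bot (hm j) (hm j') (hminj.ne hjj)
    refine hrepr 0 (β j) ?_
    have h1 : gridVec W 0 (β j) = W 0 + β j • W 2 := by simp [gridVec]
    rw [← Submodule.mem_bot k, ← this, h1]
    exact ⟨hm1 j, h ▸ hm1 j'⟩
  · rw [hbas]
    constructor
    · intro h i j r
      refine h (Projectivization.mk k _ (hrepr (α i) (β j))) ⟨i, j, ?_⟩ _ ?_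
      · rw [hspan, Projectivization.submodule_mk]
      · rw [Projectivization.submodule_mk]
        exact Submodule.smul_mem _ _ (Submodule.mem_span_singleton_self _)
    · rintro h P ⟨i, j, hP⟩ v hv
      have := hP hv
      rw [hspan, Submodule.mem_span_singleton] at this
      obtain ⟨r, rfl⟩ := this
      exact h i j r

end Ruling

theorem mainTheorem5 {k : Type*} [Field k] [CharZero k] (Q : MvPolynomial (Fin 4) k)
    (hQ : IsSmoothQuadric Q) (a b : ℕ) (ha : 2 ≤ a) (hab : a ≤ b) (X : Set (P3 k))
    (hX : IsGrid Q a b X) (d : ℕ) (hd : 0 < d) :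
    (hilbertFn (sliceIdeal Q X d) (b * d - 1) = a * b * Nat.choose (d + 1) 2 ∧
      ImposesIndependentConditions (sliceIdeal Q X d) (b * d - 1)) ∧
    (hilbertFn (fatIdeal X d) (b * d - 1) = a * b * Nat.choose (d + 2) 3 ∧
      ImposesIndependentConditions (fatIdeal X d) (b * d - 1)) := by
  have hb : 2 ≤ b := ha.trans hab
  obtain ⟨w, c, α, β, hc, hw, hα, hβ, hXw⟩ := hX.exists_frame hQ ha hb
  have key := hilbertFn_of_gridFrame w hQ.1 hc hw hα hβ hXw hb hab d
  have h := key (b * d - 1) (by omega)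
  refine ⟨⟨h.2 hd, ?_⟩, h.1, ?_⟩
  -- The closed formula holds in every degree from bd-1 on, so its value is the eventual one.
  · filter_upwards [Filter.eventually_ge_atTop (b * d - 1)] with t ht
    rw [h.2 hd, (key t (by omega)).2 hd]
  · filter_upwards [Filter.eventually_ge_atTop (b * d - 1)] with t ht
    rw [h.1, (key t (by omega)).1]
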